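/- Let $\Theta\subseteq\mathbb{R}^d$ be a parameter set on which gradients are well defined at every point (for instance an open set or a convex set with non-empty interior; derivatives in $\theta$ are taken within $\Theta$), and let $P_\theta$, $\theta\in\Theta$, be probability measures on a measurable space $\mathcal X$ with densities $p_\theta$ with respect to a $\sigma$-finite measure $\mu$. Write $S_\theta(x)=\nabla_\theta\log p_\theta(x)$ for the score. Let $X_1,\dots,X_n$ be i.i.d. with law $P_\theta$, held by nodes $1,\dots,n$. In rounds $t=1,\dots,T$ the nodes $i=1,\dots,n$ write in turn messages $Y_{i,t}$ on a public blackboard; $Y_{i,t}$ is drawn from a channel with transition density $p(y_{i,t}\mid x_i,y_{i-1,t},\dots,y_{1,t},\pi_{t-1},\dots,\pi_1)$ with respect to a $\sigma$-finite measure $\nu_{i,t}$, where $\pi_s=(y_{1,s},\dots,y_{n,s})$. Let $\Pi$ be the transcript of all messages, $p(\pi\mid x_1,\dots,x_n)$ the product of the channel densities, $\nu=\bigotimes_{i,t}\nu_{i,t}$, $Q_\theta$ the law of $\Pi$, $q_\theta(\pi)=\int p(\pi\mid x_1,\dots,x_n)\,dP_\theta^n$ its density with respect to $\nu$, $I_\Pi(\theta)=\mathbb{E}[\nabla_\theta\log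 q_\theta(\Pi)\,(\nabla_\theta\log q_\theta(\Pi))^T]$ the Fisher information matrix of the transcript, and $I_\theta(X_1,\dots,X_n;\Pi)$ the mutual information (in nats, possibly $+\infty$) when the $X_i$ have law $P_\theta$. Let $\mathsf{JS}(P\|Q)=\mathsf{KL}(P\|\tfrac{P+Q}{2})+\mathsf{KL}(Q\|\tfrac{P+Q}{2})$. Assume: (i) for $\mu$-almost every $x$, $\theta\mapsto\sqrt{p_\theta(x)}$ is continuously differentiable on $\Theta$; (ii) for each $j$, the Fisher information $\mathbb{E}[(\partial_{\theta_j}\log p_\theta(X))^2]$, $X\sim P_\theta$, exists for all $\theta\in\Theta$ and is a continuous function of $\theta$ on $\Theta$; (iii) for each $\theta\in\Theta$, $\int p(\pi\mid x_1,\dots,x_n)^2\,dP_\theta^n<\infty$ for $\nu$-almost every $\pi$; (iv) $\mathsf{JS}(Q_\theta\|Q_{\theta+\Delta})=\tfrac14\Delta^T I_\Pi(\theta)\Delta+O(\|\Delta\|^3)$ as $\Delta\to0$ with $\theta,\theta+\Delta\in\Theta$, with constants in the $O$-term that do not depend on $\theta\in\Theta$; (v) there is $N\ge 0$ such that for all $\theta\in\Theta$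 and all unit vectors $u\in\mathbb{R}^d$ the variable $\langle u,S_\theta(X)\rangle$, $X\sim P_\theta$, is sub-Gaussian with parameter $N$: $\mathbb{E}[e^{s\langle u,S_\theta(X)\rangle}]\le e^{s^2N^2/2}$ for all $s\in\mathbb{R}$. Let $\theta_0,\theta_1$ be such that $\theta_\lambda=\lambda\theta_1+(1-\lambda)\theta_0\in\Theta$ for all $\lambda\in[0,1]$. Then $$\mathsf{JS}(Q_{\theta_0}\|Q_{\theta_1})\le\frac{\|\theta_1-\theta_0\|_2^2N^2}{2}\int_0^1 I_{\theta_\lambda}(X_1,\dots,X_n;\Pi)\,d\lambda .$$ Equivalently, if $V\in\{0,1\}$ is a fair bit and $\Pi$ has law $Q_{\theta_V}$ given $V$, then $I(V;\Pi)=\tfrac12\mathsf{JS}(Q_{\theta_0}\|Q_{\theta_1})$ and $$I(V;\Pi)\le\frac{\|\theta_1-\theta_0\|_2^2N^2}{4}\int_0^1 I_{\theta_\lambda}(X_1,\dots,X_n;\Pi)\,d\lambda .$$ -/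

import Mathlib

open MeasureTheory ProbabilityTheory InformationTheory
open scoped NNReal ENNReal

noncomputable section

/-! ### Information measures (natural logarithm throughout) -/

/-- Jensen-Shannon divergence `KL(P‖(P+Q)/2) + KL(Q‖(P+Q)/2)`. -/
def jsDiv {α : Type*} [MeasurableSpace α] (P Q : Measure α) : ℝ≥0∞ :=
  klDiv P ((2 : ℝ≥0∞)⁻¹ • (P + Q)) + klDiv Q ((2 : ℝ≥0∞)⁻¹ • (P + Q))

/-- Mutual information `I(A;B)` of a pair `(A, B)` with joint law `ρ`. -/
def mutualInfo {α β : Type*} [MeasurableSpace α] [MeasurableSpace β]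
    (ρ : Measure (α × β)) : ℝ≥0∞ :=
  klDiv ρ (ρ.fst.prod ρ.snd)

/-- The joint law of `(V, Z)`, where `V` is a fair bit and `Z` has law `Q₀` given `V = false`
and law `Q₁` given `V = true`. -/
def fairMixture {β : Type*} [MeasurableSpace β] (Q₀ Q₁ : Measure β) : Measure (Bool × β) :=
  (2 : ℝ≥0∞)⁻¹ • ((Measure.dirac false).prod Q₀ + (Measure.dirac true).prod Q₁)

/-! ### The statistical model

`p θ x` is the density of `P_θ` with respect to `μ`; only `θ ∈ Θ` matters. All derivatives in `θ`
are taken within `Θ`, so that a parameter set that is not open (a box, say) is allowed. -/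

section Model

variable {d : ℕ} {𝒳 : Type*} [MeasurableSpace 𝒳]

/-- The law `P_θ` of one sample. -/
def sampleLaw (μ : Measure 𝒳) (p : EuclideanSpace ℝ (Fin d) → 𝒳 → ℝ≥0)
    (θ : EuclideanSpace ℝ (Fin d)) : Measure 𝒳 :=
  μ.withDensity (fun x => (p θ x : ℝ≥0∞))

/-- `p θ`, `θ ∈ Θ`, are probability densities with respect to `μ`. -/
def IsDensityFamily (μ : Measure 𝒳) (Θ : Set (EuclideanSpace ℝ (Fin d)))
    (p : EuclideanSpace ℝ (Fin d) → 𝒳 → ℝ≥0) : Prop :=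
  ∀ θ ∈ Θ, Measurable (p θ) ∧ ∫⁻ x, (p θ x : ℝ≥0∞) ∂μ = 1

/-- The score `S_θ(x) = ∇_θ log p_θ(x)`. -/
def score (Θ : Set (EuclideanSpace ℝ (Fin d))) (p : EuclideanSpace ℝ (Fin d) → 𝒳 → ℝ≥0)
    (θ : EuclideanSpace ℝ (Fin d)) (x : 𝒳) : EuclideanSpace ℝ (Fin d) :=
  gradientWithin (fun θ' => Real.log (p θ' x : ℝ)) Θ θ

/-- Regularity of the densities: for `μ`-almost every `x` the square-root density is continuously
differentiable in the parameter. -/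
def SqrtDensityC1 (μ : Measure 𝒳) (Θ : Set (EuclideanSpace ℝ (Fin d)))
    (p : EuclideanSpace ℝ (Fin d) → 𝒳 → ℝ≥0) : Prop :=
  ∀ᵐ x ∂μ, ContDiffOn ℝ 1 (fun θ => √(p θ x : ℝ)) Θ

/-- The Fisher information of every component of the parameter exists and is a continuous
function of the parameter. -/
def FisherContinuous (μ : Measure 𝒳) (Θ : Set (EuclideanSpace ℝ (Fin d)))
    (p : EuclideanSpace ℝ (Fin d) → 𝒳 → ℝ≥0) : Prop :=
  ∀ j : Fin d,
    (∀ θ ∈ Θ, Integrable (fun x => (score Θ p θ x j) ^ 2) (sampleLaw μ p θ)) ∧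
    ContinuousOn (fun θ => ∫ x, (score Θ p θ x j) ^ 2 ∂(sampleLaw μ p θ)) Θ

/-- For every unit vector `u`, the variable `⟨u, S_θ(X)⟩`, `X ∼ P_θ`, is sub-Gaussian with
parameter `N`, i.e. `𝔼 exp(t⟨u, S_θ(X)⟩) ≤ exp(t²N²/2)` for all real `t`. -/
def SubGaussianScore (μ : Measure 𝒳) (Θ : Set (EuclideanSpace ℝ (Fin d)))
    (p : EuclideanSpace ℝ (Fin d) → 𝒳 → ℝ≥0) (N : ℝ≥0) : Prop :=
  ∀ θ ∈ Θ, ∀ u : EuclideanSpace ℝ (Fin d), ‖u‖ = 1 →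
    HasSubgaussianMGF (fun x => inner ℝ u (score Θ p θ x)) (N ^ 2) (sampleLaw μ p θ)

end Model

/-! ### Interactive communication over a public blackboard

In each round `t : Fin T` the nodes `i : Fin n` write, one after the other, a message on the
blackboard. The message of node `i` in round `t` has index `(t, i)`. -/

/-- Message `b` is written before message `a`. -/
def WrittenBefore {T n : ℕ} (b a : Fin T × Fin n) : Prop :=
  b.1 < a.1 ∨ (b.1 = a.1 ∧ b.2 < a.2)

/-- The content of the blackboard just before message `a` is written. -/
abbrev History {T n : ℕ} (𝒴 : Fin T × Fin n → Type*) (a : Fin T × Fin n) : Type _ :=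
  ∀ b : {b : Fin T × Fin n // WrittenBefore b a}, 𝒴 b.1

/-- A `T`-round blackboard protocol for `n` nodes with samples in `𝒳`: message `a = (t, i)` is drawn
from a channel with transition density `channel a x h` with respect to `ν a`, where `x` is the sample
of node `i` and `h` is what is on the blackboard already. -/
structure BlackboardProtocol (𝒳 : Type*) [MeasurableSpace 𝒳] {T n : ℕ}
    (𝒴 : Fin T × Fin n → Type*) [∀ a, MeasurableSpace (𝒴 a)] (ν : ∀ a, Measure (𝒴 a)) where
  channel : ∀ a : Fin T × Fin n, 𝒳 → History 𝒴 a → 𝒴 a → ℝ≥0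
  measurable_channel : ∀ a, Measurable
    (fun z : 𝒳 × History 𝒴 a × 𝒴 a => channel a z.1 z.2.1 z.2.2)
  lintegral_channel : ∀ a x h, ∫⁻ y, (channel a x h y : ℝ≥0∞) ∂(ν a) = 1

namespace BlackboardProtocol

variable {d : ℕ} {𝒳 : Type*} [MeasurableSpace 𝒳] {T n : ℕ}
  {𝒴 : Fin T × Fin n → Type*} [∀ a, MeasurableSpace (𝒴 a)] {ν : ∀ a, Measure (𝒴 a)}

/-- The transition density `p(π | x₁, …, xₙ)` of the whole transcript. -/
def transcriptChannel (K : BlackboardProtocol 𝒳 𝒴 ν) (x : Fin n → 𝒳) (π : ∀ a, 𝒴 a) : ℝ≥0 :=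
  ∏ a : Fin T × Fin n, K.channel a (x a.2) (fun b => π b.1) (π a)

/-- The joint law of `((X₁, …, Xₙ), Π)` when the `Xᵢ` are i.i.d. with law `P_θ`. -/
def jointLaw (K : BlackboardProtocol 𝒳 𝒴 ν) (μ : Measure 𝒳)
    (p : EuclideanSpace ℝ (Fin d) → 𝒳 → ℝ≥0) (θ : EuclideanSpace ℝ (Fin d)) :
    Measure ((Fin n → 𝒳) × (∀ a, 𝒴 a)) :=
  ((Measure.pi fun _ : Fin n => sampleLaw μ p θ).prod (Measure.pi ν)).withDensity
    (fun z => (K.transcriptChannel z.1 z.2 : ℝ≥0∞))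

/-- The law `Q_θ` of the transcript `Π`. -/
def transcriptLaw (K : BlackboardProtocol 𝒳 𝒴 ν) (μ : Measure 𝒳)
    (p : EuclideanSpace ℝ (Fin d) → 𝒳 → ℝ≥0) (θ : EuclideanSpace ℝ (Fin d)) :
    Measure (∀ a, 𝒴 a) :=
  (K.jointLaw μ p θ).snd

/-- The density `q_θ(π) = ∫ p(π | x₁, …, xₙ) dP_θⁿ(x₁, …, xₙ)` of the transcript `Π` with respect to
the product of the `ν a`. -/
def transcriptDensity (K : BlackboardProtocol 𝒳 𝒴 ν) (μ : Measure 𝒳)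
    (p : EuclideanSpace ℝ (Fin d) → 𝒳 → ℝ≥0) (θ : EuclideanSpace ℝ (Fin d)) (π : ∀ a, 𝒴 a) :
    ℝ≥0∞ :=
  ∫⁻ x, (K.transcriptChannel x π : ℝ≥0∞) ∂(Measure.pi fun _ : Fin n => sampleLaw μ p θ)

/-- The score `∇_θ log q_θ(π)` of the transcript. -/
def transcriptScore (K : BlackboardProtocol 𝒳 𝒴 ν) (μ : Measure 𝒳)
    (Θ : Set (EuclideanSpace ℝ (Fin d))) (p : EuclideanSpace ℝ (Fin d) → 𝒳 → ℝ≥0)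
    (θ : EuclideanSpace ℝ (Fin d)) (π : ∀ a, 𝒴 a) : EuclideanSpace ℝ (Fin d) :=
  gradientWithin (fun θ' => Real.log (K.transcriptDensity μ p θ' π).toReal) Θ θ

/-- The Fisher information matrix `I_Π(θ) = 𝔼[(∇_θ log q_θ(Π)) (∇_θ log q_θ(Π))ᵀ]`. -/
def fisherMatrix (K : BlackboardProtocol 𝒳 𝒴 ν) (μ : Measure 𝒳)
    (Θ : Set (EuclideanSpace ℝ (Fin d))) (p : EuclideanSpace ℝ (Fin d) → 𝒳 → ℝ≥0)
    (θ : EuclideanSpace ℝ (Fin d)) : Matrix (Fin d) (Fin d) ℝ :=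
  Matrix.of fun j k =>
    ∫ π, K.transcriptScore μ Θ p θ π j * K.transcriptScore μ Θ p θ π k ∂(K.transcriptLaw μ p θ)

/-- The mutual information `I_θ(X₁, …, Xₙ; Π)`. -/
def sampleTranscriptInfo (K : BlackboardProtocol 𝒳 𝒴 ν) (μ : Measure 𝒳)
    (p : EuclideanSpace ℝ (Fin d) → 𝒳 → ℝ≥0) (θ : EuclideanSpace ℝ (Fin d)) : ℝ≥0∞ :=
  mutualInfo (K.jointLaw μ p θ)

/-- The channel from the samples to the transcript is square integrable: for each `θ` and almost
every transcript `π`, `∫ p(π | x₁, …, xₙ)² dP_θⁿ < ∞`. -/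
def SquareIntegrableChannel (K : BlackboardProtocol 𝒳 𝒴 ν) (μ : Measure 𝒳)
    (Θ : Set (EuclideanSpace ℝ (Fin d))) (p : EuclideanSpace ℝ (Fin d) → 𝒳 → ℝ≥0) : Prop :=
  ∀ θ ∈ Θ, ∀ᵐ π ∂(Measure.pi ν),
    ∫⁻ x, (K.transcriptChannel x π : ℝ≥0∞) ^ 2 ∂(Measure.pi fun _ : Fin n => sampleLaw μ p θ) < ∞

/-- Uniform second-order Taylor expansion of the Jensen-Shannon divergence:
`JS(Q_θ‖Q_{θ+Δ}) = ¼ Δᵀ I_Π(θ) Δ + O(‖Δ‖³)` as `Δ → 0`, with constants independent of `θ ∈ Θ`. -/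
def UniformJSTaylor (K : BlackboardProtocol 𝒳 𝒴 ν) (μ : Measure 𝒳)
    (Θ : Set (EuclideanSpace ℝ (Fin d))) (p : EuclideanSpace ℝ (Fin d) → 𝒳 → ℝ≥0) : Prop :=
  ∃ C δ : ℝ, 0 < δ ∧ ∀ θ ∈ Θ, ∀ Δ : EuclideanSpace ℝ (Fin d), θ + Δ ∈ Θ → ‖Δ‖ ≤ δ →
    |(jsDiv (K.transcriptLaw μ p θ) (K.transcriptLaw μ p (θ + Δ))).toReal
        - 1 / 4 * dotProduct (fun j => Δ j) ((K.fisherMatrix μ Θ p θ).mulVec (fun j => Δ j))|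
      ≤ C * ‖Δ‖ ^ 3

end BlackboardProtocol

end

/-! The proof passes through the Hellinger distance. Pointwise, the Jensen-Shannon integrand of two
densities is at most `(√a - √b) ^ 2` (`jensenShannon_integrand_le`, `jsDiv_withDensity_le`). For
almost every transcript `π`, the density `q_λ(π)` is absolutely continuous in `λ` with a derivative
`h_λ(π)`, so `√q` has derivative `h / (2√q)`, and Cauchy-Schwarz on `[0,1]` gives `(√q₁ - √q₀)² ≤ ¼
∫ h² / q dλ` (`ofReal_sq_sqrt_sub_sqrt_le`). Integrated over `π`, the right side is a quarter of the
Fisher information of the transcript in the direction `θ₁ - θ₀`, averaged along the segment.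

It remains to bound this Fisher information by mutual information (`lintegral_channel_fisher_le`).
Let `s` be the score of one sample in the direction `θ₁ - θ₀`; then `h / q` is the posterior mean of
`∑ s(Xᵢ)` given the transcript. The transcript density is a product of functions of a single sample
each, so the samples stay independent given the transcript. Hence the cross terms of the squared
posterior mean integrate to `𝔼[s(Xᵢ) s(Xⱼ)] = 0`, and only the sum of the squared posterior means of
the individual scores is left.

A transport inequality (`ofReal_sum_sq_le_lintegral_klFun`) bounds that sum by `2c` times the
relative entropy of the posterior with respect to the prior, where `c = ‖θ₁ - θ₀‖² N²` is the
sub-Gaussian variance proxy of `s`. Averaged over the transcript, this entropy is the mutual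
information, and the total constant is `¼ · 2c = c / 2`. -/

/-! ### Pointwise comparison of Jensen-Shannon and squared Hellinger. -/

/-- The function is the gap in `mul_sinh_sub_cosh_mul_log_cosh_le` divided by `cosh u`. After this
division the logarithm disappears from the derivative, whose sign is that of `sinh u - u`; the
function vanishes at `0`. -/
lemma hasDerivAt_jensen_aux (u : ℝ) :
    HasDerivAt (fun u => 1 - (Real.cosh u)⁻¹ - u * (Real.sinh u / Real.cosh u)
      + Real.log (Real.cosh u)) ((Real.sinh u - u) / Real.cosh u ^ 2) u := by
  have hc : Real.cosh u ≠ 0 := (Real.cosh_pos u).ne'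
  have h := ((((Real.hasDerivAt_cosh u).inv hc).const_sub 1).sub
    ((hasDerivAt_id u).mul ((Real.hasDerivAt_sinh u).div (Real.hasDerivAt_cosh u) hc))).add
    ((Real.hasDerivAt_cosh u).log hc)
  refine h.congr_deriv ?_
  have := Real.cosh_sq u
  simp only [id, Pi.div_apply]
  field_simp
  rw [this]; ring

lemma mul_sinh_sub_cosh_mul_log_cosh_le_of_nonneg {u : ℝ} (hu : 0 ≤ u) :
    u * Real.sinh u - Real.cosh u * Real.log (Real.cosh u) ≤ Real.cosh u - 1 := by
  have hmono : MonotoneOn (fun u => 1 - (Real.cosh u)⁻¹ - u * (Real.sinh u / Real.cosh u)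
      + Real.log (Real.cosh u)) (Set.Ici 0) := by
    refine monotoneOn_of_deriv_nonneg (convex_Ici 0)
      (fun x _ => (hasDerivAt_jensen_aux x).continuousAt.continuousWithinAt)
      (fun x _ => (hasDerivAt_jensen_aux x).differentiableAt.differentiableWithinAt) ?_
    intro x hx
    rw [interior_Ici] at hx
    rw [(hasDerivAt_jensen_aux x).deriv]
    have := Real.self_le_sinh_iff.2 (le_of_lt hx)
    exact div_nonneg (by linarith) (sq_nonneg _)
  have h := hmono (Set.mem_Ici.2 le_rfl) (Set.mem_Ici.2 hu) hu
  have hc := Real.cosh_pos u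
  simp only [Real.cosh_zero, Real.sinh_zero, inv_one, sub_self, zero_mul, Real.log_one,
    zero_add] at h
  have h2 := mul_nonneg hc.le h
  have h3 : Real.cosh u * (1 - (Real.cosh u)⁻¹ - u * (Real.sinh u / Real.cosh u)
      + Real.log (Real.cosh u))
      = Real.cosh u - 1 - u * Real.sinh u + Real.cosh u * Real.log (Real.cosh u) := by
    field_simp
  linarith

lemma mul_sinh_sub_cosh_mul_log_cosh_le (u : ℝ) :
    u * Real.sinh u - Real.cosh u * Real.log (Real.cosh u) ≤ Real.cosh u - 1 := by
  rcases le_total 0 u with h | h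
  · exact mul_sinh_sub_cosh_mul_log_cosh_le_of_nonneg h
  · have := mul_sinh_sub_cosh_mul_log_cosh_le_of_nonneg (u := -u) (by linarith)
    simp only [Real.sinh_neg, Real.cosh_neg] at this
    linarith

/-- Pointwise comparison of the Jensen-Shannon and the squared Hellinger integrands, in terms of
square roots. -/
lemma sq_mul_log_add_le {A B : ℝ} (hA : 0 < A) (hB : 0 < B) :
    A ^ 2 * Real.log (A ^ 2) + B ^ 2 * Real.log (B ^ 2)
      - (A ^ 2 + B ^ 2) * Real.log ((A ^ 2 + B ^ 2) / 2) ≤ (A - B) ^ 2 := by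
  -- With `u = log (A / B)`, `cosh u` and `sinh u` are `(A² ± B²) / (2AB)`; multiplying the
  -- hyperbolic inequality by `2AB` gives the claim.
  have h := mul_sinh_sub_cosh_mul_log_cosh_le (Real.log A - Real.log B)
  have e1 : Real.exp (Real.log A - Real.log B) = A / B := by
    rw [Real.exp_sub, Real.exp_log hA, Real.exp_log hB]
  have e2 : Real.exp (-(Real.log A - Real.log B)) = B / A := by
    rw [neg_sub, Real.exp_sub, Real.exp_log hA, Real.exp_log hB]
  have hc : Real.cosh (Real.log A - Real.log B) = ((A ^ 2 + B ^ 2) / 2) / (A * B) := by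
    rw [Real.cosh_eq, e1, e2]; field_simp
  have hs : Real.sinh (Real.log A - Real.log B) = (A ^ 2 - B ^ 2) / 2 / (A * B) := by
    rw [Real.sinh_eq, e1, e2]; field_simp
  rw [hc, hs, Real.log_div (by positivity) (by positivity), Real.log_mul hA.ne' hB.ne'] at h
  have h2 := mul_le_mul_of_nonneg_left h (by positivity : 0 ≤ 2 * (A * B))
  rw [Real.log_pow, Real.log_pow]
  have e3 : 2 * (A * B) * ((Real.log A - Real.log B) * ((A ^ 2 - B ^ 2) / 2 / (A * B)) -
      (A ^ 2 + B ^ 2) / 2 / (A * B) *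
        (Real.log ((A ^ 2 + B ^ 2) / 2) - (Real.log A + Real.log B)))
      = (Real.log A - Real.log B) * (A ^ 2 - B ^ 2) - (A ^ 2 + B ^ 2) *
        (Real.log ((A ^ 2 + B ^ 2) / 2) - (Real.log A + Real.log B)) := by
    field_simp
  have e4 : 2 * (A * B) * ((A ^ 2 + B ^ 2) / 2 / (A * B) - 1) = (A - B) ^ 2 := by
    field_simp; ring
  rw [e3, e4] at h2
  push_cast
  linarith

lemma mul_klFun_div {a m : ℝ} (hm : m ≠ 0) (ha : a ≠ 0) :
    m * klFun (a / m) = a * Real.log a - a * Real.log m + m - a := by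
  rw [klFun_apply, Real.log_div ha hm]; field_simp

/-- The linear terms of the two `klFun` cancel, which leaves `sq_mul_log_add_le` at `A = √a`, `B =
√b`. If exactly one of the densities vanishes, the left side is `log 2` times the other, and `log 2
≤ 1` suffices. -/
lemma jensenShannon_integrand_le {a b : ℝ} (ha : 0 ≤ a) (hb : 0 ≤ b) :
    (a + b) / 2 * klFun (a / ((a + b) / 2)) + (a + b) / 2 * klFun (b / ((a + b) / 2))
      ≤ (√a - √b) ^ 2 := by
  have hlog2 : Real.log 2 ≤ 1 := by
    have := Real.log_le_sub_one_of_pos (x := 2) (by norm_num); linarith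
  rcases ha.eq_or_lt with rfl | ha
  · rcases hb.eq_or_lt with rfl | hb
    · simp
    · have : b / ((0 + b) / 2) = 2 := by field_simp; ring
      rw [this, zero_div, klFun_zero, klFun_apply, Real.sqrt_zero, zero_sub, neg_sq,
        Real.sq_sqrt hb.le]
      nlinarith
  rcases hb.eq_or_lt with rfl | hb
  · have : a / ((a + 0) / 2) = 2 := by field_simp; ring
    rw [this, zero_div, klFun_zero, klFun_apply, Real.sqrt_zero, sub_zero,
      Real.sq_sqrt ha.le]
    nlinarith
  have h := sq_mul_log_add_le (Real.sqrt_pos.2 ha) (Real.sqrt_pos.2 hb)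
  rw [Real.sq_sqrt ha.le, Real.sq_sqrt hb.le] at h
  rw [mul_klFun_div (by positivity) ha.ne', mul_klFun_div (by positivity) hb.ne']
  linarith

/-! ### Young's inequality and sub-Gaussian variables. -/

/-- Young's inequality for the pair `klFun`, `exp - 1`. -/
lemma mul_le_klFun_add_exp {r : ℝ} (hr : 0 ≤ r) (y : ℝ) :
    r * y ≤ klFun r + (Real.exp y - 1) := by
  rcases hr.eq_or_lt with rfl | hr
  · simp [klFun_zero, Real.exp_nonneg]
  · have h := Real.add_one_le_exp (y - Real.log r)
    rw [Real.exp_sub, Real.exp_log hr, le_div_iff₀ hr] at h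
    rw [klFun_apply]; nlinarith

/-- Since `1 + tX ≤ exp (tX)`, the function `exp (c t² / 2) - 1 - t 𝔼X` is nonnegative and vanishes
at `t = 0`; its derivative there, `-𝔼X`, must be zero. -/
lemma ProbabilityTheory.HasSubgaussianMGF.integral_eq_zero {Ω : Type*} {mΩ : MeasurableSpace Ω}
    {P : Measure Ω} [IsProbabilityMeasure P] {X : Ω → ℝ} {c : ℝ≥0}
    (h : HasSubgaussianMGF X c P) : ∫ ω, X ω ∂P = 0 := by
  set E := ∫ ω, X ω ∂P with hE
  have hmin : ∀ t : ℝ, 0 ≤ Real.exp (c * t ^ 2 / 2) - 1 - t * E := by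
    intro t
    have h1 : ∫ ω, (t * X ω + 1) ∂P ≤ ∫ ω, Real.exp (t * X ω) ∂P :=
      integral_mono ((h.integrable.const_mul t).add (integrable_const 1))
        (h.integrable_exp_mul t) (fun ω => Real.add_one_le_exp _)
    have h2 := h.mgf_le t
    rw [integral_add (h.integrable.const_mul t) (integrable_const 1),
      integral_const_mul] at h1
    simp only [integral_const, probReal_univ, smul_eq_mul, mul_one] at h1
    rw [mgf] at h2
    linarith
  have hder : HasDerivAt (fun t : ℝ => Real.exp (c * t ^ 2 / 2) - 1 - t * E) (-E) 0 := by
    have h1 : HasDerivAt (fun t : ℝ => (c : ℝ) * t ^ 2 / 2) 0 0 := by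
      simpa using (((hasDerivAt_id (0 : ℝ)).pow 2).const_mul (c : ℝ)).div_const 2
    have := (h1.exp.sub_const 1).sub ((hasDerivAt_id (0 : ℝ)).mul_const E)
    refine this.congr_deriv ?_
    simp
  have hloc : IsLocalMin (fun t : ℝ => Real.exp (c * t ^ 2 / 2) - 1 - t * E) 0 := by
    refine Filter.Eventually.of_forall fun t => ?_
    simpa using hmin t
  have := hloc.hasDerivAt_eq_zero hder
  linarith

/-! ### Square roots along absolutely continuous curves. -/

lemma LipschitzOnWith.comp_absolutelyContinuousOnInterval {f φ : ℝ → ℝ} {K : ℝ≥0} {s : Set ℝ}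
    {a b : ℝ} (hφ : LipschitzOnWith K φ s) (hf : AbsolutelyContinuousOnInterval f a b)
    (hfs : ∀ x ∈ Set.uIcc a b, f x ∈ s) :
    AbsolutelyContinuousOnInterval (fun x => φ (f x)) a b := by
  rw [absolutelyContinuousOnInterval_iff] at hf ⊢
  intro ε hε
  obtain ⟨δ, hδ, h⟩ := hf (ε / (K + 1)) (by positivity)
  refine ⟨δ, hδ, fun E hE hlen => ?_⟩
  have h1 := h E hE hlen
  calc ∑ i ∈ Finset.range E.1, dist (φ (f (E.2 i).1)) (φ (f (E.2 i).2))
      ≤ ∑ i ∈ Finset.range E.1, K * dist (f (E.2 i).1) (f (E.2 i).2) :=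
        Finset.sum_le_sum fun i hi =>
          hφ.dist_le_mul (f (E.2 i).1) (hfs _ (hE.1 i hi).1) (f (E.2 i).2) (hfs _ (hE.1 i hi).2)
    _ = K * ∑ i ∈ Finset.range E.1, dist (f (E.2 i).1) (f (E.2 i).2) := by rw [Finset.mul_sum]
    _ ≤ (K + 1) * ∑ i ∈ Finset.range E.1, dist (f (E.2 i).1) (f (E.2 i).2) := by
        refine mul_le_mul_of_nonneg_right (by linarith) (Finset.sum_nonneg fun _ _ => dist_nonneg)
    _ < (K + 1) * (ε / (K + 1)) := by gcongr
    _ = ε := by field_simp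

lemma lipschitzOnWith_sqrt_Ici {ε : ℝ} (hε : 0 < ε) :
    LipschitzOnWith (Real.toNNReal (1 / √ε)) Real.sqrt (Set.Ici ε) := by
  refine LipschitzOnWith.of_dist_le_mul fun x hx y hy => ?_
  simp only [Set.mem_Ici] at hx hy
  rw [Real.coe_toNNReal _ (by positivity), Real.dist_eq, Real.dist_eq]
  have hsx : √ε ≤ √x := Real.sqrt_le_sqrt hx
  have hse : 0 < √ε := Real.sqrt_pos.2 hε
  have hsy : 0 ≤ √y := Real.sqrt_nonneg _
  have e : x - y = (√x - √y) * (√x + √y) := by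
    nlinarith [Real.sq_sqrt (hε.le.trans hx), Real.sq_sqrt (hε.le.trans hy)]
  rw [e, abs_mul, abs_of_nonneg (a := √x + √y) (by linarith), one_div, ← div_eq_inv_mul,
    le_div_iff₀ hse]
  gcongr
  linarith

lemma sq_integral_le_integral_sq {Ω : Type*} {mΩ : MeasurableSpace Ω} {P : Measure Ω}
    [IsProbabilityMeasure P] {u : Ω → ℝ} (hu : Integrable u P) (hu2 : Integrable (fun x => u x ^ 2) P) :
    (∫ x, u x ∂P) ^ 2 ≤ ∫ x, u x ^ 2 ∂P := by
  set c := ∫ x, u x ∂P with hc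
  have h : 0 ≤ ∫ x, (u x - c) ^ 2 ∂P := integral_nonneg fun x => sq_nonneg _
  have e : ∀ x, (u x - c) ^ 2 = u x ^ 2 - 2 * c * u x + c ^ 2 := fun x => by ring
  simp_rw [e] at h
  have hs : Integrable (fun x => u x ^ 2 - 2 * c * u x) P := hu2.sub (hu.const_mul _)
  rw [integral_add hs (integrable_const _), integral_sub hu2
    (hu.const_mul _), integral_const_mul, ← hc] at h
  simp only [integral_const, probReal_univ, smul_eq_mul, one_mul] at h
  nlinarith

open Set in
/-- The squared increment of `√q` along an absolutely continuous curve `q` is at most a quarter of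
the Fisher information integral `∫ q'² / q`. -/
lemma ofReal_sq_sqrt_sub_sqrt_le {q h : ℝ → ℝ} (hint : IntervalIntegrable h volume 0 1)
    (hq : ∀ l ∈ Icc (0 : ℝ) 1, q l = q 0 + ∫ t in (0 : ℝ)..l, h t)
    (hq0 : ∀ l ∈ Icc (0 : ℝ) 1, 0 ≤ q l) (hzero : ∀ l ∈ Icc (0 : ℝ) 1, q l = 0 → h l = 0) :
    ENNReal.ofReal ((√(q 1) - √(q 0)) ^ 2)
      ≤ ∫⁻ l in Icc (0 : ℝ) 1, ENNReal.ofReal (h l ^ 2 / (4 * q l)) := by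
  -- The curve `q` is controlled on `[0,1]` only, while derivatives see a neighbourhood; `q'` is a
  -- version of `q` defined on the whole line.
  set q' : ℝ → ℝ := fun l => q 0 + ∫ t in (0 : ℝ)..l, h t with hq'
  have hac : AbsolutelyContinuousOnInterval q' 0 1 :=
    (LipschitzWith.const (q 0)).lipschitzOnWith.absolutelyContinuousOnInterval.add
      (hint.absolutelyContinuousOnInterval_intervalIntegral (by simp))
  have hqc : ContinuousOn q' (Icc 0 1) := by simpa [uIcc_of_le] using hac.continuousOn
  have hder : ∀ᵐ x, x ∈ uIcc (0 : ℝ) 1 → HasDerivAt q' (h x) x := by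
    filter_upwards [hint.ae_hasDerivAt_integral] with x hx hx1
    exact (hx hx1 0 (by simp)).const_add _
  have hqq' : ∀ l ∈ Icc (0 : ℝ) 1, q' l = q l := fun l hl => (hq l hl).symm
  rcases eq_or_ne (∫⁻ l in Icc (0 : ℝ) 1, ENNReal.ofReal (h l ^ 2 / (4 * q l))) ∞ with htop | htop
  · rw [htop]; exact le_top
  have hhm : AEStronglyMeasurable h (volume.restrict (Icc 0 1)) := by
    have := hint.1.aestronglyMeasurable
    rwa [restrict_Ioc_eq_restrict_Icc] at this
  have hhi : IntegrableOn h (Icc 0 1) := by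
    have := hint.1
    rwa [← integrableOn_Icc_iff_integrableOn_Ioc] at this
  have hqm : AEStronglyMeasurable q (volume.restrict (Icc 0 1)) :=
    (hqc.congr (fun l hl => (hqq' l hl).symm)).aestronglyMeasurable measurableSet_Icc
  have hnn : 0 ≤ᵐ[volume.restrict (Icc (0:ℝ) 1)] fun l => h l ^ 2 / (4 * q l) := by
    filter_upwards [ae_restrict_mem measurableSet_Icc] with l hl
    have := hq0 l hl
    positivity
  have hInt : IntegrableOn (fun l => h l ^ 2 / (4 * q l)) (Icc 0 1) := by
    refine (lintegral_ofReal_ne_top_iff_integrable ?_ hnn).1 htop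
    exact ((hhm.aemeasurable.pow_const 2).div (hqm.aemeasurable.const_mul 4)).aestronglyMeasurable
  rw [← ofReal_integral_eq_lintegral_ofReal hInt hnn]
  apply ENNReal.ofReal_le_ofReal
  have hP : IsProbabilityMeasure (volume.restrict (Icc (0:ℝ) 1)) := ⟨by simp⟩
  -- The square root is not Lipschitz at `0`, so `√q` need not be absolutely continuous a priori.
  -- Shifting by `ε` repairs this, and the bound does not depend on `ε`, so `ε → 0` is harmless.
  have key : ∀ ε > (0 : ℝ), (√(q 1 + ε) - √(q 0 + ε)) ^ 2
      ≤ ∫ l in Icc (0 : ℝ) 1, h l ^ 2 / (4 * q l) := by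
    intro ε hε
    have hAC : AbsolutelyContinuousOnInterval (fun l => √(q' l + ε)) 0 1 := by
      refine (lipschitzOnWith_sqrt_Ici hε).comp_absolutelyContinuousOnInterval
        (f := fun l => q' l + ε)
        (hac.add (LipschitzWith.const ε).lipschitzOnWith.absolutelyContinuousOnInterval) ?_
      intro x hx
      rw [uIcc_of_le zero_le_one] at hx
      have := hq0 x hx
      simp only [mem_Ici]
      rw [hqq' x hx]; linarith
    have hd : ∀ᵐ x, x ∈ uIcc (0 : ℝ) 1 →
        deriv (fun l => √(q' l + ε)) x = h x / (2 * √(q x + ε)) := by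
      filter_upwards [hder] with x hx hx1
      have hx2 := hx1
      rw [uIcc_of_le zero_le_one] at hx2
      have h0 := hq0 x hx2
      have := ((hx hx1).add_const ε).sqrt (by rw [hqq' x hx2]; positivity)
      rw [this.deriv, hqq' x hx2]
    have hftc := hAC.integral_deriv_eq_sub
    have h01 : (0 : ℝ) ∈ Icc (0:ℝ) 1 := by simp
    have h11 : (1 : ℝ) ∈ Icc (0:ℝ) 1 := by simp
    rw [hqq' 0 h01, hqq' 1 h11, intervalIntegral.integral_of_le zero_le_one,
      ← integral_Icc_eq_integral_Ioc] at hftc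
    have hcongr : ∫ x in Icc (0:ℝ) 1, deriv (fun l => √(q' l + ε)) x
        = ∫ x in Icc (0:ℝ) 1, h x / (2 * √(q x + ε)) := by
      refine setIntegral_congr_ae measurableSet_Icc ?_
      filter_upwards [hd] with x hx hx1
      exact hx (by rwa [uIcc_of_le zero_le_one])
    rw [hcongr] at hftc
    rw [← hftc]
    have hum : AEStronglyMeasurable (fun x => h x / (2 * √(q x + ε)))
        (volume.restrict (Icc 0 1)) :=
      (hhm.aemeasurable.div ((hqm.aemeasurable.add_const ε).sqrt.const_mul 2)).aestronglyMeasurable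
    have hbound : ∀ l ∈ Icc (0 : ℝ) 1,
        (h l / (2 * √(q l + ε))) ^ 2 ≤ h l ^ 2 / (4 * q l) := by
      intro l hl
      have h0 := hq0 l hl
      rw [div_pow, mul_pow, Real.sq_sqrt (by positivity)]
      -- Where `q` vanishes, the right side is a division by zero, hence `0`; the hypothesis `hzero`
      -- makes the left side vanish too.
      rcases h0.eq_or_lt with h0 | h0
      · simp [hzero l hl h0.symm]
      · gcongr
        · norm_num
        · linarith
    have hu2 : Integrable (fun l => (h l / (2 * √(q l + ε))) ^ 2)
        (volume.restrict (Icc (0:ℝ) 1)) := by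
      refine hInt.mono' (hum.pow 2) ?_
      filter_upwards [ae_restrict_mem measurableSet_Icc] with l hl
      rw [Real.norm_of_nonneg (sq_nonneg _)]
      exact hbound l hl
    have hu : Integrable (fun l => h l / (2 * √(q l + ε)))
        (volume.restrict (Icc (0:ℝ) 1)) := by
      refine (hhi.abs.const_mul (1 / (2 * √ε))).mono' hum ?_
      filter_upwards [ae_restrict_mem measurableSet_Icc] with l hl
      have h0 := hq0 l hl
      rw [Real.norm_eq_abs, abs_div, abs_of_nonneg (a := 2 * √(q l + ε)) (by positivity),
        div_eq_inv_mul, ← one_div]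
      gcongr
      linarith
    refine (sq_integral_le_integral_sq hu hu2).trans ?_
    refine integral_mono_ae hu2 hInt ?_
    filter_upwards [ae_restrict_mem measurableSet_Icc] with l hl using hbound l hl
  have hlim : Filter.Tendsto (fun ε : ℝ => (√(q 1 + ε) - √(q 0 + ε)) ^ 2)
      (nhdsWithin 0 (Ioi 0)) (nhds ((√(q 1) - √(q 0)) ^ 2)) := by
    have : Continuous (fun ε : ℝ => (√(q 1 + ε) - √(q 0 + ε)) ^ 2) := by fun_prop
    have h2 := this.tendsto 0
    simp only [add_zero] at h2
    exact h2.mono_left nhdsWithin_le_nhds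
  exact le_of_tendsto hlim (by filter_upwards [self_mem_nhdsWithin] with ε hε using key ε hε)

/-! ### Divergences of measures given by densities, and the fair bit. -/

/-- Adding a function of zero integral does not increase the integral of the positive part when the
sum stays nonnegative. -/
lemma lintegral_ofReal_add_le {Ω : Type*} {mΩ : MeasurableSpace Ω} {ν : Measure Ω} {A B : Ω → ℝ}
    (hA : AEStronglyMeasurable A ν) (hA0 : 0 ≤ᵐ[ν] A) (hB : Integrable B ν)
    (hB0 : ∫ x, B x ∂ν = 0) (hAB : 0 ≤ᵐ[ν] fun x => A x + B x) :
    ∫⁻ x, ENNReal.ofReal (A x + B x) ∂ν ≤ ∫⁻ x, ENNReal.ofReal (A x) ∂ν := by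
  rcases eq_or_ne (∫⁻ x, ENNReal.ofReal (A x) ∂ν) ∞ with htop | htop
  · rw [htop]; exact le_top
  have hAi : Integrable A ν := (lintegral_ofReal_ne_top_iff_integrable hA hA0).1 htop
  rw [← ofReal_integral_eq_lintegral_ofReal hAi hA0,
    ← ofReal_integral_eq_lintegral_ofReal (f := fun x => A x + B x) (hAi.add hB) hAB,
    integral_add hAi hB, hB0, add_zero]

/-- The Kullback-Leibler divergence of two measures given by densities. -/
lemma klDiv_withDensity {α : Type*} [MeasurableSpace α] {ν : Measure α} {a m : α → ℝ≥0∞}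
    (ha : Measurable a) (hm : Measurable m) [IsFiniteMeasure (ν.withDensity a)]
    [IsFiniteMeasure (ν.withDensity m)] (h0 : ∀ᵐ x ∂ν, m x = 0 → a x = 0) :
    klDiv (ν.withDensity a) (ν.withDensity m)
      = ∫⁻ x, m x * ENNReal.ofReal (klFun (a x / m x).toReal) ∂ν := by
  have hmtop : ∀ᵐ x ∂ν, m x < ∞ := by
    refine ae_lt_top hm ?_
    have := measure_ne_top (ν.withDensity m) Set.univ
    rwa [withDensity_apply _ MeasurableSet.univ, Measure.restrict_univ] at this
  have hr : Measurable fun x => a x / m x := ha.div hm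
  have hP : ν.withDensity a = (ν.withDensity m).withDensity (fun x => a x / m x) := by
    rw [← withDensity_mul _ hm hr]
    refine withDensity_congr_ae ?_
    filter_upwards [h0, hmtop] with x hx hx'
    simp only [Pi.mul_apply]
    rw [ENNReal.mul_div_cancel' hx (fun h => absurd h hx'.ne)]
  have hac : ν.withDensity a ≪ ν.withDensity m := by
    rw [hP]; exact withDensity_absolutelyContinuous _ _
  have hrn : (ν.withDensity a).rnDeriv (ν.withDensity m) =ᵐ[ν.withDensity m]
      fun x => a x / m x := by
    conv_lhs => rw [hP]
    exact Measure.rnDeriv_withDensity _ hr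
  rw [klDiv_eq_lintegral_klFun_of_ac hac,
    lintegral_congr_ae (g := fun x => ENNReal.ofReal (klFun (a x / m x).toReal)) (by
      filter_upwards [hrn] with x hx; rw [hx]),
    lintegral_withDensity_eq_lintegral_mul _ hm]
  · rfl
  · exact (measurable_klFun.comp hr.ennreal_toReal).ennreal_ofReal

/-- The Jensen-Shannon divergence is at most the squared Hellinger distance. -/
lemma jsDiv_withDensity_le {α : Type*} [MeasurableSpace α] {ν : Measure α} {a b : α → ℝ≥0∞}
    (ha : Measurable a) (hb : Measurable b) [IsFiniteMeasure (ν.withDensity a)]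
    [IsFiniteMeasure (ν.withDensity b)] :
    jsDiv (ν.withDensity a) (ν.withDensity b)
      ≤ ∫⁻ x, ENNReal.ofReal ((√(b x).toReal - √(a x).toReal) ^ 2) ∂ν := by
  have htop : ∀ f : α → ℝ≥0∞, Measurable f → IsFiniteMeasure (ν.withDensity f) →
      ∀ᵐ x ∂ν, f x < ∞ := by
    intro f hf hfin
    refine ae_lt_top hf ?_
    have := measure_ne_top (ν.withDensity f) Set.univ
    rwa [withDensity_apply _ MeasurableSet.univ, Measure.restrict_univ] at this
  set m : α → ℝ≥0∞ := (2 : ℝ≥0∞)⁻¹ • (a + b) with hm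
  have hmm : Measurable m := (ha.add hb).const_smul _
  have hM : (2 : ℝ≥0∞)⁻¹ • (ν.withDensity a + ν.withDensity b) = ν.withDensity m := by
    rw [hm, withDensity_smul _ (ha.add hb), withDensity_add_left ha]
  have hfin : IsFiniteMeasure (ν.withDensity m) := by
    rw [← hM]
    exact Measure.smul_finite _ (by simp)
  have hm_eq : ∀ x, m x = 2⁻¹ * (a x + b x) := fun x => rfl
  have h0 : ∀ x, m x = 0 → a x = 0 ∧ b x = 0 := by
    intro x hx
    rw [hm_eq] at hx
    simpa using hx
  rw [jsDiv, hM, klDiv_withDensity ha hmm (ae_of_all _ fun x hx => (h0 x hx).1),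
    klDiv_withDensity hb hmm (ae_of_all _ fun x hx => (h0 x hx).2), ← lintegral_add_left]
  swap
  · exact hmm.mul ((measurable_klFun.comp (ha.div hmm).ennreal_toReal).ennreal_ofReal)
  refine lintegral_mono_ae ?_
  filter_upwards [htop a ha ‹_›, htop b hb ‹_›] with x hax hbx
  have hmt : (m x).toReal = ((a x).toReal + (b x).toReal) / 2 := by
    rw [hm_eq, ENNReal.toReal_mul, ENNReal.toReal_add hax.ne hbx.ne]
    simp; ring
  have hmx : m x = ENNReal.ofReal (m x).toReal := by
    rw [ENNReal.ofReal_toReal]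
    rw [hm_eq]
    exact ENNReal.mul_ne_top (by simp) (by simp [hax.ne, hbx.ne])
  rw [ENNReal.toReal_div, ENNReal.toReal_div]
  conv_lhs => rw [hmx]
  rw [ENNReal.toReal_ofReal ENNReal.toReal_nonneg, ← ENNReal.ofReal_mul ENNReal.toReal_nonneg,
    ← ENNReal.ofReal_mul ENNReal.toReal_nonneg, ← ENNReal.ofReal_add]
  · refine ENNReal.ofReal_le_ofReal ?_
    rw [hmt, sub_sq_comm]
    exact jensenShannon_integrand_le ENNReal.toReal_nonneg ENNReal.toReal_nonneg
  · exact mul_nonneg ENNReal.toReal_nonneg (klFun_nonneg (by positivity))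
  · exact mul_nonneg ENNReal.toReal_nonneg (klFun_nonneg (by positivity))

lemma lintegral_dirac_prod {α β : Type*} [MeasurableSpace α] [MeasurableSpace β] (x : α)
    (Q : Measure β) [SFinite Q] {f : α × β → ℝ≥0∞} (hf : Measurable f) :
    ∫⁻ z, f z ∂((Measure.dirac x).prod Q) = ∫⁻ y, f (x, y) ∂Q := by
  rw [Measure.dirac_prod, lintegral_map hf measurable_prodMk_left]

/-- The information a sample carries about the fair bit selecting its law is half the
Jensen-Shannon divergence. -/
lemma mutualInfo_fairMixture {β : Type*} [MeasurableSpace β] (Q₀ Q₁ : Measure β)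
    [IsProbabilityMeasure Q₀] [IsProbabilityMeasure Q₁] :
    mutualInfo (fairMixture Q₀ Q₁) = (2 : ℝ≥0∞)⁻¹ * jsDiv Q₀ Q₁ := by
  set M : Measure β := (2 : ℝ≥0∞)⁻¹ • (Q₀ + Q₁) with hM
  have hMfin : IsFiniteMeasure M := Measure.smul_finite _ (by simp)
  have hac0 : Q₀ ≪ M := by
    refine Measure.AbsolutelyContinuous.mk fun s hs h => ?_
    simp only [hM, Measure.smul_apply, Measure.add_apply, smul_eq_mul, mul_eq_zero,
      ENNReal.inv_eq_zero, ENNReal.ofNat_ne_top, false_or, add_eq_zero] at h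
    exact h.1
  have hac1 : Q₁ ≪ M := by
    refine Measure.AbsolutelyContinuous.mk fun s hs h => ?_
    simp only [hM, Measure.smul_apply, Measure.add_apply, smul_eq_mul, mul_eq_zero,
      ENNReal.inv_eq_zero, ENNReal.ofNat_ne_top, false_or, add_eq_zero] at h
    exact h.2
  have hfst : (fairMixture Q₀ Q₁).fst
      = (2 : ℝ≥0∞)⁻¹ • (Measure.dirac false + Measure.dirac true) := by
    ext s hs
    rw [Measure.fst_apply hs, fairMixture]
    simp only [Measure.smul_apply, Measure.add_apply, smul_eq_mul]
    rw [← Set.prod_univ, Measure.prod_prod, Measure.prod_prod]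
    simp
  have hsnd : (fairMixture Q₀ Q₁).snd = M := by
    ext s hs
    rw [Measure.snd_apply hs, fairMixture, hM]
    simp only [Measure.smul_apply, Measure.add_apply, smul_eq_mul]
    rw [← Set.univ_prod, Measure.prod_prod, Measure.prod_prod]
    simp
  have hbase : (fairMixture Q₀ Q₁).fst.prod (fairMixture Q₀ Q₁).snd
      = (2 : ℝ≥0∞)⁻¹ • ((Measure.dirac false).prod M + (Measure.dirac true).prod M) := by
    rw [hfst, hsnd, Measure.prod_smul_left, Measure.add_prod]
  set B : Measure (Bool × β) :=
    (2 : ℝ≥0∞)⁻¹ • ((Measure.dirac false).prod M + (Measure.dirac true).prod M) with hB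
  have hBint : ∀ f : Bool × β → ℝ≥0∞, Measurable f →
      ∫⁻ z, f z ∂B = 2⁻¹ * (∫⁻ y, f (false, y) ∂M + ∫⁻ y, f (true, y) ∂M) := by
    intro f hf
    rw [hB, lintegral_smul_measure, lintegral_add_measure, lintegral_dirac_prod _ _ hf,
      lintegral_dirac_prod _ _ hf, smul_eq_mul]
  -- The density of the joint law with respect to the product `B` of its marginals: on each fibre it
  -- is `dQᵥ/dM`. The divergence thus splits into two fibre terms of weight `1/2`, which are the two
  -- terms of `jsDiv`.
  set r : Bool × β → ℝ≥0∞ :=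
    fun z => if z.1 = true then Q₁.rnDeriv M z.2 else Q₀.rnDeriv M z.2 with hr
  have hrm : Measurable r := by
    refine Measurable.ite (measurableSet_eq_fun measurable_fst measurable_const) ?_ ?_
    · exact (Measure.measurable_rnDeriv _ _).comp measurable_snd
    · exact (Measure.measurable_rnDeriv _ _).comp measurable_snd
  have hρ : fairMixture Q₀ Q₁ = B.withDensity r := by
    ext s hs
    have hsf : MeasurableSet (Prod.mk false ⁻¹' s) := measurable_prodMk_left hs
    have hst : MeasurableSet (Prod.mk true ⁻¹' s) := measurable_prodMk_left hs
    rw [withDensity_apply _ hs, ← lintegral_indicator hs, hBint _ (hrm.indicator hs),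
      fairMixture]
    simp only [Measure.smul_apply, Measure.add_apply, smul_eq_mul]
    rw [Measure.dirac_prod, Measure.dirac_prod, Measure.map_apply measurable_prodMk_left hs,
      Measure.map_apply measurable_prodMk_left hs]
    congr 2
    · rw [← Measure.setLIntegral_rnDeriv hac0, ← lintegral_indicator hsf]
      rfl
    · rw [← Measure.setLIntegral_rnDeriv hac1, ← lintegral_indicator hst]
      rfl
  have hBfin : IsFiniteMeasure B := Measure.smul_finite _ (by simp)
  have hρfin : IsFiniteMeasure (fairMixture Q₀ Q₁) := Measure.smul_finite _ (by simp)
  have hρfin' : IsFiniteMeasure (B.withDensity r) := hρ ▸ hρfin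
  -- `B` is written with density `1` so that `klDiv_withDensity` applies with `B` itself as the base
  -- measure.
  have hB1 : B = B.withDensity 1 := withDensity_one.symm
  have hB1fin : IsFiniteMeasure (B.withDensity 1) := hB1 ▸ hBfin
  rw [mutualInfo, hbase, hρ]
  conv_lhs => rw [hB1, withDensity_one]
  conv_lhs => enter [2]; rw [hB1]
  rw [klDiv_withDensity hrm measurable_one (ae_of_all _ fun x hx => by simp at hx),
    hBint _ (by
      simp only [Pi.one_apply, one_mul, div_one]
      exact (measurable_klFun.comp hrm.ennreal_toReal).ennreal_ofReal),
    jsDiv, ← hM, klDiv_eq_lintegral_klFun_of_ac hac0, klDiv_eq_lintegral_klFun_of_ac hac1]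
  simp [hr]

/-! ### Product measures and the total mass of the transcript channel. -/

lemma lintegral_fin_prod_eq_prod {n : ℕ} {E : Type*} [MeasurableSpace E] {μ : Measure E}
    [SigmaFinite μ] {f : Fin n → E → ℝ≥0∞} (hf : ∀ i, Measurable (f i)) :
    ∫⁻ x : Fin n → E, ∏ i, f i (x i) ∂(Measure.pi fun _ => μ) = ∏ i, ∫⁻ x, f i x ∂μ := by
  induction n with
  | zero => simp
  | succ n ih =>
    have hm : Measurable fun x : Fin n → E => ∏ i : Fin n, f (Fin.succ i) (x i) :=
      Finset.measurable_prod _ fun i _ => (hf _).comp (measurable_pi_apply i)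
    have hm' : Measurable fun x : Fin (n + 1) → E => ∏ i, f i (x i) :=
      Finset.measurable_prod _ fun i _ => (hf _).comp (measurable_pi_apply i)
    rw [← ((measurePreserving_piFinSuccAbove (fun _ => μ) 0).symm).lintegral_comp hm']
    simp_rw [MeasurableEquiv.piFinSuccAbove_symm_apply, Fin.insertNthEquiv,
      Fin.prod_univ_succ, Fin.insertNth_zero, Equiv.coe_fn_mk, Fin.cons_succ,
      Fin.cons_zero]
    rw [← ih fun i => hf _]
    exact lintegral_prod_mul (hf 0).aemeasurable hm.aemeasurable

lemma pi_withDensity {n : ℕ} {E : Type*} [MeasurableSpace E] {μ : Measure E}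
    [SigmaFinite μ] {p : E → ℝ≥0∞} (hp : Measurable p) [SigmaFinite (μ.withDensity p)] :
    (Measure.pi fun _ : Fin n => μ.withDensity p)
      = (Measure.pi fun _ : Fin n => μ).withDensity fun x => ∏ i, p (x i) := by
  refine Measure.pi_eq fun s hs => ?_
  rw [withDensity_apply _ (MeasurableSet.univ_pi hs),
    ← lintegral_indicator (MeasurableSet.univ_pi hs)]
  have : ∀ x : Fin n → E, (Set.univ.pi s).indicator (fun x => ∏ i, p (x i)) x
      = ∏ i, (s i).indicator p (x i) := by
    intro x
    by_cases hx : x ∈ Set.univ.pi s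
    · rw [Set.indicator_of_mem hx]
      exact Finset.prod_congr rfl fun i _ => (Set.indicator_of_mem (hx i trivial) _).symm
    · rw [Set.indicator_of_notMem hx]
      simp only [Set.mem_pi, Set.mem_univ, true_implies, not_forall] at hx
      obtain ⟨i, hi⟩ := hx
      exact (Finset.prod_eq_zero (Finset.mem_univ i) (Set.indicator_of_notMem hi _)).symm
  simp_rw [this]
  rw [lintegral_fin_prod_eq_prod fun i => hp.indicator (hs i)]
  exact Finset.prod_congr rfl fun i _ => by
    rw [withDensity_apply _ (hs i), lintegral_indicator (hs i)]

lemma lmarginal_mul_left {δ : Type*} {X : δ → Type*} [∀ i, MeasurableSpace (X i)]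
    [DecidableEq δ] (μ : ∀ i, Measure (X i)) (s : Finset δ) {f g : (∀ i, X i) → ℝ≥0∞}
    (hg : Measurable g) (x : ∀ i, X i)
    (hf : ∀ y : ∀ i : s, X i, f (Function.updateFinset x s y) = f x) :
    (∫⋯∫⁻_s, (fun z => f z * g z) ∂μ) x = f x * (∫⋯∫⁻_s, g ∂μ) x := by
  simp only [lmarginal, hf]
  exact lintegral_const_mul _ (hg.comp measurable_updateFinset)

namespace BlackboardProtocol

variable {𝒳 : Type*} [MeasurableSpace 𝒳] {T n : ℕ}
  {𝒴 : Fin T × Fin n → Type*} [∀ a, MeasurableSpace (𝒴 a)] {ν : ∀ a, Measure (𝒴 a)}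

/-- The writing order is the strict lexicographic order on (round, node). This allows induction over
messages along a linear order. -/
lemma writtenBefore_of_toLex_le {a b : Fin T × Fin n} (h : toLex a ≤ toLex b) :
    ¬ WrittenBefore b a := by
  rw [Prod.Lex.toLex_le_toLex] at h
  rintro (h1 | ⟨h1, h2⟩)
  · rcases h with h | ⟨h, -⟩
    · exact lt_asymm h h1
    · exact h1.ne h.symm
  · rcases h with h | ⟨-, h⟩
    · exact h.ne h1.symm
    · exact h2.not_ge h

lemma measurable_channel_message (K : BlackboardProtocol 𝒳 𝒴 ν) (a : Fin T × Fin n) :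
    Measurable fun z : 𝒳 × (∀ a, 𝒴 a) => K.channel a z.1 (fun b => z.2 b.1) (z.2 a) := by
  refine (K.measurable_channel a).comp (measurable_fst.prodMk (Measurable.prodMk ?_ ?_))
  · exact measurable_pi_lambda _ fun b => (measurable_pi_apply b.1).comp measurable_snd
  · exact (measurable_pi_apply a).comp measurable_snd

/-- The transcript density is a probability density, whatever the samples are. -/
lemma lintegral_transcriptChannel (K : BlackboardProtocol 𝒳 𝒴 ν) [∀ a, SigmaFinite (ν a)]
    (x : Fin n → 𝒳) : ∫⁻ π, (K.transcriptChannel x π : ℝ≥0∞) ∂(Measure.pi ν) = 1 := by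
  set c : Fin T × Fin n → (∀ a, 𝒴 a) → ℝ≥0∞ :=
    fun a π => (K.channel a (x a.2) (fun b => π b.1) (π a) : ℝ≥0∞) with hc
  have hcm : ∀ a, Measurable (c a) := fun a =>
    ((K.measurable_channel_message a).comp measurable_prodMk_left).coe_nnreal_ennreal
  -- A base point is needed to evaluate marginals. It is built in the order of writing: once a
  -- history exists, the next channel has mass `1`, so its message space is nonempty.
  have hnonempty : Nonempty (∀ a, 𝒴 a) := by
    have hwf : ∀ a : Fin T × Fin n, Nonempty (𝒴 a) := by
      intro a
      induction h : toLex a using WellFoundedLT.induction generalizing a with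
      | ind l ih =>
        have hist : History 𝒴 a := fun b => Classical.choice (ih (toLex b.1) (by
          rw [← h, Prod.Lex.toLex_lt_toLex]; exact b.2) b.1 rfl)
        by_contra hempty
        rw [not_nonempty_iff] at hempty
        have := K.lintegral_channel a (x a.2) hist
        simp at this
    exact ⟨fun a => Classical.choice (hwf a)⟩
  -- The latest messages are integrated out first. When the earliest message `a` joins `s`, all of
  -- `s` comes later, so the channel of `a` does not depend on the coordinates in `s` and leaves the
  -- inner integral; its own integral is then `1`.
  have key : ∀ s : Finset (Fin T × Fin n),
      (∫⋯∫⁻_s, (fun π => ∏ a ∈ s, c a π) ∂ν) = fun _ => 1 := by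
    intro s
    refine Finset.induction_on_min_value (fun a => toLex a) s ?_ ?_
    · simp
    · intro a s has hmin ih
      have hprod : Measurable fun π => ∏ b ∈ s, c b π :=
        Finset.measurable_prod _ fun b _ => hcm b
      have hins : (fun π => ∏ b ∈ insert a s, c b π) = fun π => c a π * ∏ b ∈ s, c b π := by
        ext π; rw [Finset.prod_insert has]
      have hpull : (∫⋯∫⁻_s, (fun π => c a π * ∏ b ∈ s, c b π) ∂ν) = c a := by
        ext π
        rw [lmarginal_mul_left ν s hprod π, ih, mul_one]
        intro y
        have hout : ∀ b ∉ s, Function.updateFinset π s y b = π b := fun b hb => by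
          simp [Function.updateFinset, hb]
        simp only [hc]
        rw [hout a has]
        congr 2
        funext b
        exact hout _ fun hb => writtenBefore_of_toLex_le (hmin _ hb) b.2
      ext π
      rw [hins, lmarginal_insert (fun π => c a π * ∏ b ∈ s, c b π) ((hcm a).mul hprod) has, hpull,
        ← K.lintegral_channel a (x a.2) (fun b => π b.1)]
      refine lintegral_congr fun y => ?_
      simp only [hc, Function.update_self]
      congr 2
      funext b
      refine Function.update_of_ne ?_ _ _
      intro h
      exact writtenBefore_of_toLex_le le_rfl (h ▸ b.2)
  obtain ⟨π₀⟩ := hnonempty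
  rw [lintegral_eq_lmarginal_univ π₀, ← congrFun (key Finset.univ) π₀]
  congr 1
  ext π
  simp [transcriptChannel, hc]

end BlackboardProtocol

/-! ### Transport inequality on product spaces. -/

/-- Transport inequality for a density `R` with respect to a product measure: the sum of the squared
means of a sub-Gaussian statistic of the coordinates is bounded by the relative entropy. -/
lemma ofReal_sum_sq_le_lintegral_klFun {n : ℕ} {X : Type*} [MeasurableSpace X] {P : Measure X}
    [IsProbabilityMeasure P] {s : X → ℝ} {c : ℝ≥0} (hs : HasSubgaussianMGF s c P)
    {R : (Fin n → X) → ℝ} (hRm : Measurable R) (hR0 : ∀ x, 0 ≤ R x)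
    (hRi : Integrable R (Measure.pi fun _ => P)) (hR1 : ∫ x, R x ∂(Measure.pi fun _ => P) = 1)
    (hRs : ∀ i, Integrable (fun x => R x * s (x i)) (Measure.pi fun _ => P)) :
    ENNReal.ofReal (∑ i, (∫ x, R x * s (x i) ∂(Measure.pi fun _ => P)) ^ 2)
      ≤ ENNReal.ofReal (2 * c) *
        ∫⁻ x, ENNReal.ofReal (klFun (R x)) ∂(Measure.pi fun _ => P) := by
  set Pn : Measure (Fin n → X) := Measure.pi fun _ => P with hPn
  -- With `c = 0` the statistic is almost surely zero; the case is separate because the optimal `t`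
  -- below divides by `c`.
  rcases eq_or_ne c 0 with rfl | hc
  · have h0 := hs.ae_eq_zero_of_hasSubgaussianMGF_zero
    have : ∀ i, ∫ x, R x * s (x i) ∂Pn = 0 := by
      intro i
      refine integral_eq_zero_of_ae ?_
      have : ∀ᵐ x ∂Pn, s (x i) = 0 := (Measure.tendsto_eval_ae_ae (μ := fun _ => P)).eventually h0
      filter_upwards [this] with x hx
      simp [hx]
    simp [this]
  have hcpos : (0 : ℝ) < c := by positivity
  rcases eq_or_ne (∫⁻ x, ENNReal.ofReal (klFun (R x)) ∂Pn) ∞ with htop | htop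
  · rw [htop, ENNReal.mul_top]
    · exact le_top
    · simpa using hc
  have hkl0 : 0 ≤ᵐ[Pn] fun x => klFun (R x) := ae_of_all _ fun x => klFun_nonneg (hR0 x)
  have hkl : Integrable (fun x => klFun (R x)) Pn :=
    (lintegral_ofReal_ne_top_iff_integrable
      (measurable_klFun.comp hRm).aestronglyMeasurable hkl0).1 htop
  rw [← ofReal_integral_eq_lintegral_ofReal hkl hkl0, ← ENNReal.ofReal_mul (by positivity)]
  refine ENNReal.ofReal_le_ofReal ?_
  set m : Fin n → ℝ := fun i => ∫ x, R x * s (x i) ∂Pn with hm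
  -- The maximiser of `t mᵢ - c t² / 2`, with maximum `mᵢ² / (2c)`.
  set t : Fin n → ℝ := fun i => m i / c with ht
  have hei : ∀ i, Integrable (fun z => Real.exp (t i * s z - c * t i ^ 2 / 2)) P := by
    intro i
    simp_rw [Real.exp_sub]
    exact (hs.integrable_exp_mul (t i)).div_const _
  have hexp : ∀ x : Fin n → X, Real.exp (∑ i, (t i * s (x i) - c * t i ^ 2 / 2))
      = ∏ i, Real.exp (t i * s (x i) - c * t i ^ 2 / 2) := fun x => Real.exp_sum _ _
  have hEi : Integrable (fun x : Fin n → X =>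
      Real.exp (∑ i, (t i * s (x i) - c * t i ^ 2 / 2))) Pn := by
    simp_rw [hexp]
    exact Integrable.fintype_prod (f := fun i z => Real.exp (t i * s z - c * t i ^ 2 / 2)) hei
  have hE1 : ∫ x, Real.exp (∑ i, (t i * s (x i) - c * t i ^ 2 / 2)) ∂Pn ≤ 1 := by
    simp_rw [hexp]
    rw [integral_fintype_prod_eq_prod (fun i z => Real.exp (t i * s z - c * t i ^ 2 / 2))]
    refine Finset.prod_le_one (fun i _ => integral_nonneg fun z => (Real.exp_pos _).le) ?_
    intro i _
    simp_rw [Real.exp_sub]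
    rw [integral_div, div_le_one (Real.exp_pos _)]
    exact hs.mgf_le (t i)
  have hterm : ∀ i, Integrable (fun x => t i * (R x * s (x i)) - c * t i ^ 2 / 2 * R x) Pn :=
    fun i => ((hRs i).const_mul _).sub (hRi.const_mul _)
  have hE' : Integrable (fun x : Fin n → X =>
      Real.exp (∑ i, (t i * s (x i) - c * t i ^ 2 / 2)) - 1) Pn := hEi.sub (integrable_const _)
  -- Young's inequality at the exponent `∑ (tᵢ s(xᵢ) - c tᵢ² / 2)`. The subtracted terms normalise
  -- the exponential moment to at most `1` by sub-Gaussianity and independence, so only the entropy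
  -- remains on the right.
  have hyoung : ∫ x, ∑ i, (t i * (R x * s (x i)) - c * t i ^ 2 / 2 * R x) ∂Pn
      ≤ ∫ x, (klFun (R x) + (Real.exp (∑ i, (t i * s (x i) - c * t i ^ 2 / 2)) - 1)) ∂Pn := by
    refine integral_mono (integrable_finsetSum _ fun i _ => hterm i)
      (hkl.add (hEi.sub (integrable_const _))) fun x => ?_
    have := mul_le_klFun_add_exp (hR0 x) (∑ i, (t i * s (x i) - c * t i ^ 2 / 2))
    refine le_trans (le_of_eq ?_) this
    rw [Finset.mul_sum]
    exact Finset.sum_congr rfl fun i _ => by ring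
  rw [integral_finsetSum _ fun i _ => hterm i, integral_add hkl hE',
    integral_sub hEi (integrable_const _)] at hyoung
  have hval : ∀ i, ∫ x, (t i * (R x * s (x i)) - c * t i ^ 2 / 2 * R x) ∂Pn
      = m i ^ 2 / (2 * c) := by
    intro i
    rw [integral_sub ((hRs i).const_mul _) (hRi.const_mul _), integral_const_mul,
      integral_const_mul, hR1]
    change t i * m i - _ = _
    simp only [ht]
    field_simp; ring
  simp_rw [hval] at hyoung
  rw [← Finset.sum_div] at hyoung
  simp only [integral_const, probReal_univ, smul_eq_mul, mul_one] at hyoung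
  have : (∑ i, m i ^ 2) / (2 * c) ≤ ∫ x, klFun (R x) ∂Pn := by linarith
  rw [div_le_iff₀ (by positivity)] at this
  linarith

/-! ### Fisher information at the output of a product channel. -/

section Channel

variable {n : ℕ} {X Y : Type*} [MeasurableSpace X] [MeasurableSpace Y]

lemma measurable_prod_channel {f : Fin n → X → Y → ℝ≥0}
    (hf : ∀ i, Measurable (Function.uncurry (f i))) :
    Measurable fun z : (Fin n → X) × Y => ∏ i, f i (z.1 i) z.2 :=
  Finset.measurable_prod _ fun i _ => by
    have h : Measurable fun z : (Fin n → X) × Y => (z.1 i, z.2) :=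
      ((measurable_pi_apply i).comp measurable_fst).prodMk measurable_snd
    exact (hf i).comp h

/-- Integrating a statistic of the input against a normalised channel. -/
lemma integrable_channel_mul {A : Type*} [MeasurableSpace A] {ρ : Measure A} [SFinite ρ]
    {ν : Measure Y} [SigmaFinite ν] {κ : A → Y → ℝ≥0} (hκ : Measurable (Function.uncurry κ))
    (hκ1 : ∀ x, ∫⁻ y, (κ x y : ℝ≥0∞) ∂ν = 1) {g : A → ℝ} (hg : Integrable g ρ) :
    Integrable (fun z : A × Y => (κ z.1 z.2 : ℝ) * g z.1) (ρ.prod ν) ∧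
      ∫ z : A × Y, (κ z.1 z.2 : ℝ) * g z.1 ∂(ρ.prod ν) = ∫ x, g x ∂ρ := by
  have hκx : ∀ x, Integrable (fun y => (κ x y : ℝ)) ν ∧ ∫ y, (κ x y : ℝ) ∂ν = 1 := by
    intro x
    have hm : Measurable fun y => κ x y := hκ.comp measurable_prodMk_left
    have h := hκ1 x
    have hint : Integrable (fun y => (κ x y : ℝ)) ν := by
      refine ⟨hm.coe_nnreal_real.aestronglyMeasurable, ?_⟩
      rw [hasFiniteIntegral_iff_enorm]
      simp [h]
    refine ⟨hint, ?_⟩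
    rw [integral_eq_lintegral_of_nonneg_ae (ae_of_all _ fun y => NNReal.coe_nonneg _)
      hint.aestronglyMeasurable]
    simp [h]
  have hint : Integrable (fun z : A × Y => (κ z.1 z.2 : ℝ) * g z.1) (ρ.prod ν) := by
    have hm : AEStronglyMeasurable (fun z : A × Y => (κ z.1 z.2 : ℝ) * g z.1) (ρ.prod ν) :=
      hκ.coe_nnreal_real.aestronglyMeasurable.mul hg.aestronglyMeasurable.comp_fst
    rw [integrable_prod_iff hm]
    refine ⟨ae_of_all _ fun x => (hκx x).1.mul_const (g x), ?_⟩
    refine hg.norm.congr (ae_of_all _ fun x => ?_)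
    simp only [norm_mul, Real.norm_of_nonneg (NNReal.coe_nonneg _)]
    rw [integral_mul_const, (hκx x).2, one_mul]
  refine ⟨hint, ?_⟩
  rw [integral_prod _ hint]
  refine integral_congr_ae (ae_of_all _ fun x => ?_)
  simp only
  rw [integral_mul_const, (hκx x).2, one_mul]

/-- The divergence between the joint law of input and output of a channel and the product of the
laws, in terms of the posterior densities. -/
lemma klDiv_channel_eq {A : Type*} [MeasurableSpace A] {ρ : Measure A} [IsProbabilityMeasure ρ]
    {ν : Measure Y} [SigmaFinite ν] {κ : A → Y → ℝ≥0} (hκ : Measurable (Function.uncurry κ))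
    (hκ1 : ∀ x, ∫⁻ y, (κ x y : ℝ≥0∞) ∂ν = 1) :
    klDiv ((ρ.prod ν).withDensity fun z => (κ z.1 z.2 : ℝ≥0∞))
        (ρ.prod (ν.withDensity fun y => ∫⁻ x, (κ x y : ℝ≥0∞) ∂ρ))
      = ∫⁻ y, (∫⁻ x, (κ x y : ℝ≥0∞) ∂ρ) * ∫⁻ x, ENNReal.ofReal (klFun
          ((κ x y : ℝ≥0∞) / ∫⁻ x, (κ x y : ℝ≥0∞) ∂ρ).toReal) ∂ρ ∂ν := by
  have hκe : Measurable fun z : A × Y => (κ z.1 z.2 : ℝ≥0∞) := hκ.coe_nnreal_ennreal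
  set q : Y → ℝ≥0∞ := fun y => ∫⁻ x, (κ x y : ℝ≥0∞) ∂ρ with hq
  have hqm : Measurable q := hκe.lintegral_prod_left'
  have hqm2 : Measurable fun z : A × Y => q z.2 := hqm.comp measurable_snd
  have htot : ∫⁻ z : A × Y, (κ z.1 z.2 : ℝ≥0∞) ∂(ρ.prod ν) = 1 := by
    rw [lintegral_prod _ hκe.aemeasurable]; simp [hκ1]
  have hqtot : ∫⁻ y, q y ∂ν = 1 := by
    rw [← htot, lintegral_prod_symm _ hκe.aemeasurable]
  have hfin1 : IsFiniteMeasure ((ρ.prod ν).withDensity fun z => (κ z.1 z.2 : ℝ≥0∞)) :=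
    isFiniteMeasure_withDensity (by simp [htot])
  have hfinq : IsFiniteMeasure (ν.withDensity q) := isFiniteMeasure_withDensity (by simp [hqtot])
  have hprod : ρ.prod (ν.withDensity q) = (ρ.prod ν).withDensity fun z => q z.2 :=
    prod_withDensity_right hqm
  have hfin2 : IsFiniteMeasure ((ρ.prod ν).withDensity fun z => q z.2) := hprod ▸ inferInstance
  -- Absolute continuity holds only almost everywhere: `q y = 0` forces `κ x y = 0` for almost every
  -- `x`, not for every `x`.
  have h0 : ∀ᵐ z ∂(ρ.prod ν), q z.2 = 0 → (κ z.1 z.2 : ℝ≥0∞) = 0 := by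
    have hms : MeasurableSet {z : A × Y | q z.2 = 0} := hqm2 (measurableSet_singleton 0)
    have hz : ∫⁻ z, {z : A × Y | q z.2 = 0}.indicator (fun z => (κ z.1 z.2 : ℝ≥0∞)) z
        ∂(ρ.prod ν) = 0 := by
      rw [lintegral_prod_symm _ (hκe.indicator hms).aemeasurable]
      refine lintegral_eq_zero_of_ae_eq_zero (ae_of_all _ fun y => ?_)
      by_cases hy : q y = 0
      · simp only [Set.indicator, Set.mem_ofPred_eq, hy, if_true]
        exact hy
      · simp [Set.indicator, hy]
    rw [lintegral_eq_zero_iff (hκe.indicator hms)] at hz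
    filter_upwards [hz] with z hz hqz
    have hmem : z ∈ {z : A × Y | q z.2 = 0} := hqz
    simpa [Set.indicator_of_mem hmem] using hz
  rw [hprod, klDiv_withDensity hκe hqm2 h0, lintegral_prod_symm]
  · refine lintegral_congr fun y => ?_
    refine lintegral_const_mul (q y)
      (f := fun x => ENNReal.ofReal (klFun ((κ x y : ℝ≥0∞) / q y).toReal)) ?_
    exact (measurable_klFun.comp (((hκe.comp measurable_prodMk_right).div
      measurable_const).ennreal_toReal)).ennreal_ofReal
  · exact (hqm2.mul (measurable_klFun.comp
      (hκe.div hqm2).ennreal_toReal).ennreal_ofReal).aemeasurable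

/-- Conditional independence of the coordinates given the output of a product channel, in integrated
form. -/
lemma integral_channel_mul_mul {P : Measure X} [SigmaFinite P] (f : Fin n → X → ℝ) (s : X → ℝ)
    {i j : Fin n} (hij : i ≠ j) :
    (∫ x : Fin n → X, ∏ l, f l (x l) ∂(Measure.pi fun _ => P)) *
        ∫ x : Fin n → X, (∏ l, f l (x l)) * (s (x i) * s (x j)) ∂(Measure.pi fun _ => P)
      = (∫ x : Fin n → X, (∏ l, f l (x l)) * s (x i) ∂(Measure.pi fun _ => P)) *
        ∫ x : Fin n → X, (∏ l, f l (x l)) * s (x j) ∂(Measure.pi fun _ => P) := by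
  -- Each integrand is written as a product over coordinates, so all four integrals factorise,
  -- without any integrability condition, and can be compared coordinate by coordinate.
  have e1 : ∀ (k : Fin n) (x : Fin n → X), (∏ l, f l (x l)) * s (x k)
      = ∏ l, f l (x l) * (if l = k then s (x l) else 1) := by
    intro k x
    rw [Finset.prod_mul_distrib, Finset.prod_ite_eq' Finset.univ k]
    simp
  have e2 : ∀ x : Fin n → X, (∏ l, f l (x l)) * (s (x i) * s (x j))
      = ∏ l, f l (x l) * ((if l = i then s (x l) else 1) * (if l = j then s (x l) else 1)) := by
    intro x
    rw [Finset.prod_mul_distrib, Finset.prod_mul_distrib, Finset.prod_ite_eq' Finset.univ i,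
      Finset.prod_ite_eq' Finset.univ j]
    simp
  simp_rw [e1, e2]
  rw [integral_fintype_prod_eq_prod f,
    integral_fintype_prod_eq_prod (fun l z => f l z *
      ((if l = i then s z else 1) * (if l = j then s z else 1))),
    integral_fintype_prod_eq_prod (fun l z => f l z * (if l = i then s z else 1)),
    integral_fintype_prod_eq_prod (fun l z => f l z * (if l = j then s z else 1)),
    ← Finset.prod_mul_distrib, ← Finset.prod_mul_distrib]
  refine Finset.prod_congr rfl fun l _ => ?_
  by_cases hi : l = i
  · have hj : l ≠ j := hi ▸ hij
    simp [hi, hij, mul_comm]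
  · simp [hi]

/-- The Fisher information of the output of a product channel in the direction of a sub-Gaussian
score is bounded by the mutual information of input and output. -/
lemma lintegral_channel_fisher_le {P : Measure X} [IsProbabilityMeasure P] {s : X → ℝ}
    {c : ℝ≥0} (hs : HasSubgaussianMGF s c P) {ν : Measure Y} [SigmaFinite ν]
    {f : Fin n → X → Y → ℝ≥0} (hf : ∀ i, Measurable (Function.uncurry (f i)))
    (hf1 : ∀ x : Fin n → X, ∫⁻ y, ((∏ i, f i (x i) y : ℝ≥0) : ℝ≥0∞) ∂ν = 1) :
    ∫⁻ y, ENNReal.ofReal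
        ((∫ x : Fin n → X, ((∏ i, f i (x i) y : ℝ≥0) : ℝ) * ∑ i, s (x i)
            ∂(Measure.pi fun _ => P)) ^ 2 /
          (∫⁻ x : Fin n → X, ((∏ i, f i (x i) y : ℝ≥0) : ℝ≥0∞)
            ∂(Measure.pi fun _ => P)).toReal) ∂ν
      ≤ ENNReal.ofReal (2 * c) *
        klDiv (((Measure.pi fun _ => P).prod ν).withDensity fun z : (Fin n → X) × Y =>
            ((∏ i, f i (z.1 i) z.2 : ℝ≥0) : ℝ≥0∞))
          ((Measure.pi fun _ => P).prod (ν.withDensity fun y => ∫⁻ x : Fin n → X,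
            ((∏ i, f i (x i) y : ℝ≥0) : ℝ≥0∞) ∂(Measure.pi fun _ => P))) := by
  set Pn : Measure (Fin n → X) := Measure.pi fun _ => P with hPn
  set κ : (Fin n → X) → Y → ℝ≥0 := fun x y => ∏ i, f i (x i) y with hκdef
  have hκ : Measurable (Function.uncurry κ) := measurable_prod_channel hf
  rw [klDiv_channel_eq hκ hf1]
  set q : Y → ℝ≥0∞ := fun y => ∫⁻ x, (κ x y : ℝ≥0∞) ∂Pn with hq
  have hκe : Measurable fun z : (Fin n → X) × Y => (κ z.1 z.2 : ℝ≥0∞) := hκ.coe_nnreal_ennreal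
  have hκy : ∀ y, Measurable fun x => κ x y := fun y => hκ.comp measurable_prodMk_right
  have hqm : Measurable q := hκe.lintegral_prod_left'
  have hqtot : ∫⁻ y, q y ∂ν = 1 := by
    rw [← lintegral_prod_symm (μ := Pn) (fun z => (κ z.1 z.2 : ℝ≥0∞)) hκe.aemeasurable,
      lintegral_prod _ hκe.aemeasurable]
    rw [lintegral_congr hf1]
    simp
  have hqtop : ∀ᵐ y ∂ν, q y < ∞ := ae_lt_top hqm (by simp [hqtot])
  have hsi : ∀ i : Fin n, Integrable (fun x : Fin n → X => s (x i)) Pn :=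
    fun i => integrable_comp_eval (μ := fun _ : Fin n => P) hs.integrable
  have hsij : ∀ i j : Fin n, i ≠ j → Integrable (fun x : Fin n → X => s (x i) * s (x j)) Pn ∧
      ∫ x : Fin n → X, s (x i) * s (x j) ∂Pn = 0 := by
    intro i j hij
    have e : ∀ x : Fin n → X, s (x i) * s (x j)
        = ∏ l, ((if l = i then s (x l) else 1) * (if l = j then s (x l) else 1)) := by
      intro x
      rw [Finset.prod_mul_distrib, Finset.prod_ite_eq' Finset.univ i,
        Finset.prod_ite_eq' Finset.univ j]
      simp
    simp_rw [e]
    constructor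
    · refine Integrable.fintype_prod (μ := fun _ : Fin n => P)
        (f := fun l z => (if l = i then s z else 1) * (if l = j then s z else 1)) fun l => ?_
      by_cases hi : l = i
      · have hj : l ≠ j := hi ▸ hij
        simpa [hi, hij] using hs.integrable
      · by_cases hj : l = j
        · have hji : j ≠ i := hij.symm
          simpa [hj, hji] using hs.integrable
        · simp [hi, hj]
    · rw [integral_fintype_prod_eq_prod
        (fun l z => (if l = i then s z else 1) * (if l = j then s z else 1))]
      refine Finset.prod_eq_zero (Finset.mem_univ i) ?_
      simp [hij, hs.integral_eq_zero]
  set H : Fin n → Y → ℝ := fun i y => ∫ x, (κ x y : ℝ) * s (x i) ∂Pn with hH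
  -- The cross term `Hᵢ Hⱼ / q` equals `Gᵢⱼ` by conditional independence. In this form it is visibly
  -- integrable, with integral `𝔼[s(Xᵢ) s(Xⱼ)] = 0`. The diagonal part `A` may have infinite
  -- integral, which `lintegral_ofReal_add_le` tolerates.
  set G : Fin n → Fin n → Y → ℝ := fun i j y =>
    if i = j then 0 else ∫ x, (κ x y : ℝ) * (s (x i) * s (x j)) ∂Pn with hG
  have hHm : ∀ i, AEStronglyMeasurable (H i) ν := fun i =>
    (integrable_channel_mul hκ hf1 (hsi i)).1.integral_prod_right.aestronglyMeasurable
  have hGi : ∀ i j, Integrable (G i j) ν ∧ ∫ y, G i j y ∂ν = 0 := by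
    intro i j
    by_cases hij : i = j
    · simp [hG, hij]
    · have h := integrable_channel_mul hκ hf1 (hsij i j hij).1
      simp only [hG, hij, if_false]
      refine ⟨h.1.integral_prod_right, ?_⟩
      rw [← (hsij i j hij).2, ← h.2, integral_prod_symm _ h.1]
  set A : Y → ℝ := fun y => ∑ i, H i y ^ 2 / (q y).toReal with hA
  set B : Y → ℝ := fun y => ∑ i, ∑ j, G i j y with hB
  have hAm : AEStronglyMeasurable A ν := by
    refine Finset.aestronglyMeasurable_fun_sum _ fun i _ => ?_
    exact (((hHm i).aemeasurable.pow_const 2).div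
      hqm.ennreal_toReal.aemeasurable).aestronglyMeasurable
  have hA0 : ∀ y, 0 ≤ A y := fun y =>
    Finset.sum_nonneg fun i _ => div_nonneg (sq_nonneg _) ENNReal.toReal_nonneg
  have hBi : Integrable B ν :=
    integrable_finsetSum _ fun i _ => integrable_finsetSum _ fun j _ => (hGi i j).1
  have hB0 : ∫ y, B y ∂ν = 0 := by
    rw [integral_finsetSum _ fun i _ => integrable_finsetSum _ fun j _ => (hGi i j).1]
    refine Finset.sum_eq_zero fun i _ => ?_
    rw [integral_finsetSum _ fun j _ => (hGi i j).1]
    exact Finset.sum_eq_zero fun j _ => (hGi i j).2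
  have hHi : ∀ᵐ y ∂ν, ∀ i, Integrable (fun x => (κ x y : ℝ) * s (x i)) Pn :=
    ae_all_iff.2 fun i => (integrable_channel_mul hκ hf1 (hsi i)).1.prod_left_ae
  have hqr : ∀ y, ∫ x, (κ x y : ℝ) ∂Pn = (q y).toReal := by
    intro y
    rw [integral_eq_lintegral_of_nonneg_ae (ae_of_all _ fun x => NNReal.coe_nonneg _)
      (hκy y).coe_nnreal_real.aestronglyMeasurable]
    simp [hq]
  have hsplit : ∀ᵐ y ∂ν, (∫ x, (κ x y : ℝ) * ∑ i, s (x i) ∂Pn) ^ 2 / (q y).toReal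
      = A y + B y := by
    filter_upwards [hHi, hqtop] with y hy hqy
    have hsum : ∫ x, (κ x y : ℝ) * ∑ i, s (x i) ∂Pn = ∑ i, H i y := by
      simp_rw [Finset.mul_sum]
      rw [integral_finsetSum _ fun i _ => hy i]
    have hoff : ∀ i j, G i j y = if i = j then 0 else H i y * H j y / (q y).toReal := by
      intro i j
      by_cases hij : i = j
      · simp [hG, hij]
      · simp only [hG, hij, if_false]
        rcases eq_or_ne (q y) 0 with h0 | h0
        · have hz : ∀ᵐ x ∂Pn, κ x y = 0 := by
            have := (lintegral_eq_zero_iff (hκy y).coe_nnreal_ennreal).1 h0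
            filter_upwards [this] with x hx
            simpa using hx
          rw [h0, ENNReal.toReal_zero, div_zero]
          refine integral_eq_zero_of_ae ?_
          filter_upwards [hz] with x hx
          simp [hx]
        · have hpos : (q y).toReal ≠ 0 := (ENNReal.toReal_pos h0 hqy.ne).ne'
          rw [eq_div_iff hpos, ← hqr, mul_comm]
          have := integral_channel_mul_mul (P := P) (fun l z => (f l z y : ℝ)) s hij
          simpa only [hκdef, hH, NNReal.coe_prod] using this
    rw [hsum, hA, hB, pow_two, Finset.sum_mul_sum, Finset.sum_div]
    simp only
    rw [← Finset.sum_add_distrib]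
    refine Finset.sum_congr rfl fun i _ => ?_
    simp_rw [hoff]
    rw [Finset.sum_div, ← Finset.sum_erase_add _ _ (Finset.mem_univ i), add_comm,
      Finset.sum_ite, Finset.sum_const_zero, zero_add, pow_two]
    congr 1
    refine Finset.sum_congr ?_ fun _ _ => rfl
    ext j
    simp [eq_comm]
  calc ∫⁻ y, ENNReal.ofReal ((∫ x, (κ x y : ℝ) * ∑ i, s (x i) ∂Pn) ^ 2 / (q y).toReal) ∂ν
      = ∫⁻ y, ENNReal.ofReal (A y + B y) ∂ν := lintegral_congr_ae (by
        filter_upwards [hsplit] with y hy; rw [hy])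
    _ ≤ ∫⁻ y, ENNReal.ofReal (A y) ∂ν := by
        refine lintegral_ofReal_add_le hAm (ae_of_all _ hA0) hBi hB0 ?_
        filter_upwards [hsplit] with y hy
        simp only [Pi.zero_apply]
        rw [← hy]
        exact div_nonneg (sq_nonneg _) ENNReal.toReal_nonneg
    _ ≤ ∫⁻ y, ENNReal.ofReal (2 * c) * (q y * ∫⁻ x, ENNReal.ofReal (klFun
          ((κ x y : ℝ≥0∞) / q y).toReal) ∂Pn) ∂ν := by
        refine lintegral_mono_ae ?_
        filter_upwards [hHi, hqtop] with y hy hqy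
        rcases eq_or_ne (q y) 0 with h0 | h0
        · simp [hA, h0]
        have hpos : 0 < (q y).toReal := ENNReal.toReal_pos h0 hqy.ne
        set r := (q y).toReal with hr
        -- A non-integrable function has integral `0` by convention, whereas this integral is
        -- positive.
        have hκi : Integrable (fun x => (κ x y : ℝ)) Pn := by
          by_contra hcon
          have := hqr y
          rw [integral_undef hcon] at this
          exact hpos.ne this
        have hR : ∀ x, ((κ x y : ℝ≥0∞) / q y).toReal = (κ x y : ℝ) / r := by
          intro x; rw [ENNReal.toReal_div, ENNReal.coe_toReal]
        simp_rw [hR]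
        have hRs : ∀ i x, (κ x y : ℝ) / r * s (x i) = (κ x y : ℝ) * s (x i) / r := by
          intro i x; ring
        -- Here `R` is the posterior density of the input given the output `y`, relative to the
        -- prior.
        have key := ofReal_sum_sq_le_lintegral_klFun hs (R := fun x => (κ x y : ℝ) / r)
          ((hκy y).coe_nnreal_real.div_const r) (fun x => by positivity) (hκi.div_const r)
          (by rw [integral_div, hqr y, ← hr, div_self hpos.ne'])
          (fun i => by simp_rw [hRs]; exact (hy i).div_const r)
        have hAy : ENNReal.ofReal (A y) = q y * ENNReal.ofReal
            (∑ i, (∫ x, (κ x y : ℝ) / r * s (x i) ∂Pn) ^ 2) := by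
          conv_rhs => rw [← ENNReal.ofReal_toReal hqy.ne]
          rw [← ENNReal.ofReal_mul ENNReal.toReal_nonneg, ← hr, Finset.mul_sum]
          congr 1
          refine Finset.sum_congr rfl fun i _ => ?_
          simp_rw [hRs]
          rw [integral_div]
          change H i y ^ 2 / r = r * (H i y / r) ^ 2
          field_simp
        rw [hAy, mul_left_comm]
        gcongr
    _ = _ := lintegral_const_mul' _ _ ENNReal.ofReal_ne_top

end Channel

/-! ### Differentiable paths of densities and the main inequality. -/

/-- Follows from `|x| ≤ exp x + exp (-x)`. The bound depends on `c` alone, hence is uniform along a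
path; this gives the joint integrability needed for Fubini. -/
lemma ProbabilityTheory.HasSubgaussianMGF.integral_abs_le {Ω : Type*} {mΩ : MeasurableSpace Ω}
    {P : Measure Ω} {X : Ω → ℝ} {c : ℝ≥0} (h : HasSubgaussianMGF X c P)
    (hX : Integrable X P) : ∫ ω, |X ω| ∂P ≤ 2 * Real.exp (c / 2) := by
  have h1 : ∫ ω, |X ω| ∂P ≤ ∫ ω, (Real.exp (1 * X ω) + Real.exp ((-1) * X ω)) ∂P := by
    refine integral_mono hX.abs ((h.integrable_exp_mul 1).add (h.integrable_exp_mul (-1)))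
      fun ω => ?_
    have e1 := Real.add_one_le_exp (1 * X ω)
    have e2 := Real.add_one_le_exp ((-1) * X ω)
    have p1 := Real.exp_pos (1 * X ω)
    have p2 := Real.exp_pos ((-1) * X ω)
    simp only
    rcases abs_cases (X ω) with ⟨ha, -⟩ | ⟨ha, -⟩ <;> rw [ha] <;> linarith
  rw [integral_add (h.integrable_exp_mul 1) (h.integrable_exp_mul (-1))] at h1
  have h2 := h.mgf_le 1
  have h3 := h.mgf_le (-1)
  rw [mgf] at h2 h3
  have e : (c : ℝ) * 1 ^ 2 / 2 = c / 2 := by ring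
  have e' : (c : ℝ) * (-1) ^ 2 / 2 = c / 2 := by ring
  rw [e] at h2
  rw [e'] at h3
  linarith

open Set in
/-- Fundamental theorem of calculus for a product density along a differentiable path of
densities with score `s`. -/
lemma prod_density_eq_add_integral {n : ℕ} {X : Type*} {p : ℝ → X → ℝ≥0} {s : ℝ → X → ℝ}
    (hder : ∀ x, ∀ l ∈ Ioo (0 : ℝ) 1, HasDerivAt (fun l => (p l x : ℝ)) (p l x * s l x) l)
    (hcont : ∀ x, ContinuousOn (fun l => (p l x : ℝ)) (Icc 0 1))
    (hcont' : ∀ x, ContinuousOn (fun l => (p l x : ℝ) * s l x) (Icc 0 1)) (x : Fin n → X) :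
    ContinuousOn (fun l => ((∏ i, p l (x i) : ℝ≥0) : ℝ) * ∑ i, s l (x i)) (Icc 0 1) ∧
    ∀ l ∈ Icc (0 : ℝ) 1, ((∏ i, p l (x i) : ℝ≥0) : ℝ) = ((∏ i, p 0 (x i) : ℝ≥0) : ℝ)
      + ∫ t in (0 : ℝ)..l, ((∏ i, p t (x i) : ℝ≥0) : ℝ) * ∑ i, s t (x i) := by
  -- Continuity is assumed for `p` and `p * s`, not for `s`, which may misbehave at zeros of `p`.
  -- Each score is therefore paired with its own density factor.
  have heq : ∀ l, ((∏ i, p l (x i) : ℝ≥0) : ℝ) * ∑ i, s l (x i)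
      = ∑ i, (∏ j ∈ Finset.univ.erase i, (p l (x j) : ℝ)) * (p l (x i) * s l (x i)) := by
    intro l
    rw [NNReal.coe_prod, Finset.mul_sum]
    refine Finset.sum_congr rfl fun i _ => ?_
    rw [← Finset.mul_prod_erase _ _ (Finset.mem_univ i)]
    ring
  have hc : ContinuousOn (fun l => ((∏ i, p l (x i) : ℝ≥0) : ℝ) * ∑ i, s l (x i)) (Icc 0 1) := by
    simp_rw [heq]
    refine continuousOn_finsetSum _ fun i _ => ContinuousOn.mul ?_ (hcont' (x i))
    exact continuousOn_finsetProd _ fun j _ => hcont (x j)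
  refine ⟨hc, fun l hl => ?_⟩
  have hsub : Icc 0 l ⊆ Icc (0 : ℝ) 1 := Icc_subset_Icc_right hl.2
  rw [intervalIntegral.integral_eq_sub_of_hasDerivAt_of_le
    (f := fun l => ((∏ i, p l (x i) : ℝ≥0) : ℝ)) hl.1]
  · ring
  · simp_rw [NNReal.coe_prod]
    exact continuousOn_finsetProd _ fun j _ => (hcont (x j)).mono hsub
  · intro t ht
    have ht' : t ∈ Ioo (0 : ℝ) 1 := ⟨ht.1, ht.2.trans_le hl.2⟩
    rw [heq]
    simp_rw [NNReal.coe_prod]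
    have := HasDerivAt.fun_finsetProd (u := Finset.univ) (f := fun i l => (p l (x i) : ℝ))
      (x := t) fun i _ => hder (x i) t ht'
    simpa [smul_eq_mul] using this
  · refine ContinuousOn.intervalIntegrable ?_
    rw [uIcc_of_le hl.1]
    exact hc.mono hsub

open Set in
/-- The main inequality for a one-parameter family of densities: the Jensen-Shannon divergence of
the two output laws of a product channel is bounded by the integrated mutual information. -/
lemma jsDiv_channel_le {n : ℕ} {X Y : Type*} [MeasurableSpace X] [MeasurableSpace Y]
    {μ : Measure X} [SigmaFinite μ] {ν : Measure Y} [SigmaFinite ν]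
    {p : ℝ → X → ℝ≥0} {s : ℝ → X → ℝ} {c : ℝ≥0}
    (hp : Measurable (Function.uncurry p)) (hs : Measurable (Function.uncurry s))
    (hp1 : ∀ l ∈ Icc (0 : ℝ) 1, ∫⁻ x, (p l x : ℝ≥0∞) ∂μ = 1)
    (hder : ∀ x, ∀ l ∈ Ioo (0 : ℝ) 1, HasDerivAt (fun l => (p l x : ℝ)) (p l x * s l x) l)
    (hcont : ∀ x, ContinuousOn (fun l => (p l x : ℝ)) (Icc 0 1))
    (hcont' : ∀ x, ContinuousOn (fun l => (p l x : ℝ) * s l x) (Icc 0 1))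
    (hsub : ∀ l ∈ Icc (0 : ℝ) 1,
      HasSubgaussianMGF (s l) c (μ.withDensity fun x => (p l x : ℝ≥0∞)))
    {f : Fin n → X → Y → ℝ≥0} (hf : ∀ i, Measurable (Function.uncurry (f i)))
    (hf1 : ∀ x : Fin n → X, ∫⁻ y, ((∏ i, f i (x i) y : ℝ≥0) : ℝ≥0∞) ∂ν = 1)
    {P : ℝ → Measure (Fin n → X)}
    (hP : P = fun l => Measure.pi fun _ => μ.withDensity fun x => (p l x : ℝ≥0∞)) :
    jsDiv (ν.withDensity fun y => ∫⁻ x, ((∏ i, f i (x i) y : ℝ≥0) : ℝ≥0∞) ∂(P 0))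
        (ν.withDensity fun y => ∫⁻ x, ((∏ i, f i (x i) y : ℝ≥0) : ℝ≥0∞) ∂(P 1))
      ≤ ENNReal.ofReal (c / 2) * ∫⁻ l in Icc (0 : ℝ) 1,
        klDiv (((P l).prod ν).withDensity fun z : (Fin n → X) × Y =>
            ((∏ i, f i (z.1 i) z.2 : ℝ≥0) : ℝ≥0∞))
          ((P l).prod (ν.withDensity fun y => ∫⁻ x : Fin n → X,
            ((∏ i, f i (x i) y : ℝ≥0) : ℝ≥0∞) ∂(P l))) := by
  set κ : (Fin n → X) → Y → ℝ≥0 := fun x y => ∏ i, f i (x i) y with hκdef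
  have hκ : Measurable (Function.uncurry κ) := measurable_prod_channel hf
  have hκe : Measurable fun z : (Fin n → X) × Y => (κ z.1 z.2 : ℝ≥0∞) := hκ.coe_nnreal_ennreal
  set μn : Measure (Fin n → X) := Measure.pi fun _ => μ with hμn
  set w : ℝ → (Fin n → X) → ℝ≥0 := fun l x => ∏ i, p l (x i) with hw
  set σ : ℝ → (Fin n → X) → ℝ := fun l x => ∑ i, s l (x i) with hσ
  have hcoord : ∀ i : Fin n, Measurable fun z : ℝ × (Fin n → X) => (z.1, z.2 i) := fun i =>
    measurable_fst.prodMk ((measurable_pi_apply i).comp measurable_snd)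
  have hwm : Measurable fun z : ℝ × (Fin n → X) => w z.1 z.2 :=
    Finset.measurable_prod _ fun i _ => hp.comp (hcoord i)
  have hσm : Measurable fun z : ℝ × (Fin n → X) => σ z.1 z.2 :=
    Finset.measurable_sum _ fun i _ => hs.comp (hcoord i)
  have hwl : ∀ l, Measurable (w l) := fun l => hwm.comp measurable_prodMk_left
  have hσl : ∀ l, Measurable (σ l) := fun l => hσm.comp measurable_prodMk_left
  have hpl : ∀ l, Measurable (p l) := fun l => hp.comp measurable_prodMk_left
  have hκy : ∀ y, Measurable fun x => κ x y := fun y => hκ.comp measurable_prodMk_right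
  have hprob1 : ∀ l ∈ Icc (0 : ℝ) 1,
      IsProbabilityMeasure (μ.withDensity fun x => (p l x : ℝ≥0∞)) := fun l hl =>
    ⟨by rw [withDensity_apply _ MeasurableSet.univ, Measure.restrict_univ, hp1 l hl]⟩
  have hprob : ∀ l ∈ Icc (0 : ℝ) 1, IsProbabilityMeasure (P l) := fun l hl => by
    have := hprob1 l hl
    rw [hP]; infer_instance
  have hPw : ∀ l, P l = μn.withDensity fun x => (w l x : ℝ≥0∞) := by
    intro l
    rw [hP]
    simp only
    rw [pi_withDensity (hpl l).coe_nnreal_ennreal]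
    simp [hw, hμn]
  set q : ℝ → Y → ℝ≥0∞ := fun l y => ∫⁻ x, (κ x y : ℝ≥0∞) ∂(P l) with hq
  set r : ℝ → Y → ℝ := fun l y => ∫ x, (κ x y : ℝ) * w l x ∂μn with hr
  set h : ℝ → Y → ℝ := fun l y => ∫ x, (κ x y : ℝ) * (w l x * σ l x) ∂μn with hh
  have hqr : ∀ l y, (q l y).toReal = r l y := by
    intro l y
    have hm : Measurable fun x => (κ x y : ℝ) * w l x :=
      (hκy y).coe_nnreal_real.mul (hwl l).coe_nnreal_real
    simp only [hq, hr]
    rw [integral_eq_lintegral_of_nonneg_ae (ae_of_all _ fun x => by positivity)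
      hm.aestronglyMeasurable, hPw,
      lintegral_withDensity_eq_lintegral_mul _ (hwl l).coe_nnreal_ennreal
        (hκy y).coe_nnreal_ennreal]
    congr 1
    refine lintegral_congr fun x => ?_
    simp only [Pi.mul_apply]
    rw [ENNReal.ofReal_mul (NNReal.coe_nonneg _), ENNReal.ofReal_coe_nnreal,
      ENNReal.ofReal_coe_nnreal, mul_comm]
  have hhP : ∀ l y, ∫ x, (κ x y : ℝ) * σ l x ∂(P l) = h l y := by
    intro l y
    rw [hPw, integral_withDensity_eq_integral_smul (hwl l)]
    refine integral_congr_ae (ae_of_all _ fun x => ?_)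
    simp only [NNReal.smul_def, smul_eq_mul]
    ring
  have hqm : ∀ l ∈ Icc (0 : ℝ) 1, Measurable (q l) := fun l hl => by
    have := hprob l hl
    exact hκe.lintegral_prod_left'
  have hqtot : ∀ l ∈ Icc (0 : ℝ) 1, ∫⁻ y, q l y ∂ν = 1 := by
    intro l hl
    have := hprob l hl
    rw [← lintegral_prod_symm (μ := P l) (fun z => (κ z.1 z.2 : ℝ≥0∞)) hκe.aemeasurable,
      lintegral_prod _ hκe.aemeasurable]
    rw [lintegral_congr hf1]
    simp
  have h0 : (0 : ℝ) ∈ Icc (0 : ℝ) 1 := by simp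
  have h1 : (1 : ℝ) ∈ Icc (0 : ℝ) 1 := by simp
  have hσi : ∀ l ∈ Icc (0 : ℝ) 1, Integrable (σ l) (P l) ∧
      ∫ x, |σ l x| ∂(P l) ≤ n * (2 * Real.exp (c / 2)) := by
    intro l hl
    have := hprob1 l hl
    have hsi := (hsub l hl).integrable
    have hi : ∀ i : Fin n, Integrable (fun x : Fin n → X => s l (x i)) (P l) := fun i => by
      rw [hP]
      exact integrable_comp_eval (μ := fun _ : Fin n => _) hsi
    refine ⟨integrable_finsetSum _ fun i _ => hi i, ?_⟩
    calc ∫ x, |σ l x| ∂(P l) ≤ ∫ x, ∑ i : Fin n, |s l (x i)| ∂(P l) :=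
          integral_mono (integrable_finsetSum _ fun i _ => hi i).abs
            (integrable_finsetSum _ fun i _ => (hi i).abs)
            fun x => Finset.abs_sum_le_sum_abs _ _
      _ = ∑ i : Fin n, ∫ x, |s l (x i)| ∂(P l) := integral_finsetSum _ fun i _ => (hi i).abs
      _ ≤ ∑ _i : Fin n, 2 * Real.exp (c / 2) := by
          refine Finset.sum_le_sum fun i _ => ?_
          rw [hP]
          simp only
          rw [integral_comp_eval (μ := fun _ : Fin n => μ.withDensity fun x => (p l x : ℝ≥0∞))
            (i := i) (f := fun z => |s l z|) hsi.abs.aestronglyMeasurable]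
          exact (hsub l hl).integral_abs_le hsi
      _ = n * (2 * Real.exp (c / 2)) := by simp
  set I : Measure ℝ := volume.restrict (Icc (0 : ℝ) 1) with hI
  have hgm : Measurable fun z : ℝ × (Fin n → X) => (w z.1 z.2 : ℝ) * σ z.1 z.2 :=
    hwm.coe_nnreal_real.mul hσm
  have hwσ : ∀ l ∈ Icc (0 : ℝ) 1, Integrable (fun x => (w l x : ℝ) * σ l x) μn := by
    intro l hl
    have := (hσi l hl).1
    rw [hPw, integrable_withDensity_iff_integrable_smul (hwl l)] at this
    simpa [NNReal.smul_def] using this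
  have hg : Integrable (fun z : ℝ × (Fin n → X) => (w z.1 z.2 : ℝ) * σ z.1 z.2) (I.prod μn) := by
    rw [integrable_prod_iff hgm.aestronglyMeasurable]
    constructor
    · filter_upwards [ae_restrict_mem measurableSet_Icc] with l hl using hwσ l hl
    · refine Integrable.of_bound
        hgm.norm.stronglyMeasurable.integral_prod_right'.aestronglyMeasurable
        (n * (2 * Real.exp (c / 2))) ?_
      filter_upwards [ae_restrict_mem measurableSet_Icc] with l hl
      rw [Real.norm_of_nonneg (integral_nonneg fun _ => norm_nonneg _)]
      refine le_trans (le_of_eq ?_) (hσi l hl).2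
      rw [hPw, integral_withDensity_eq_integral_smul (hwl l)]
      refine integral_congr_ae (ae_of_all _ fun x => ?_)
      simp [NNReal.smul_def]
  have hκ' : Measurable (Function.uncurry fun (z : ℝ × (Fin n → X)) (y : Y) => κ z.2 y) :=
    hκ.comp ((measurable_snd.comp measurable_fst).prodMk measurable_snd)
  have hyint : ∀ᵐ y ∂ν, Integrable (fun z : ℝ × (Fin n → X) =>
      (κ z.2 y : ℝ) * ((w z.1 z.2 : ℝ) * σ z.1 z.2)) (I.prod μn) :=
    (integrable_channel_mul hκ' (fun z => hf1 z.2) hg).1.prod_left_ae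
  have hq0top : ∀ᵐ y ∂ν, q 0 y < ∞ := ae_lt_top (hqm 0 h0) (by simp [hqtot 0 h0])
  -- Differentiation under the integral is avoided: the fundamental theorem of calculus holds for
  -- every fixed `x`, and Fubini turns it into `r l y = r 0 y + ∫ h` for almost every `y`.
  have hcurve : ∀ᵐ y ∂ν, ENNReal.ofReal ((√(r 1 y) - √(r 0 y)) ^ 2)
      ≤ ∫⁻ l in Icc (0 : ℝ) 1, ENNReal.ofReal (h l y ^ 2 / (4 * r l y)) := by
    filter_upwards [hyint, hq0top] with y hy hq0
    have hint0 : Integrable (fun x => (κ x y : ℝ) * w 0 x) μn := by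
      have hm : Measurable fun x => (κ x y : ℝ) * w 0 x :=
        (hκy y).coe_nnreal_real.mul (hwl 0).coe_nnreal_real
      refine (lintegral_ofReal_ne_top_iff_integrable hm.aestronglyMeasurable
        (ae_of_all _ fun x => by positivity)).1 ?_
      have e : ∫⁻ x, ENNReal.ofReal ((κ x y : ℝ) * w 0 x) ∂μn = q 0 y := by
        simp only [hq]
        rw [hPw, lintegral_withDensity_eq_lintegral_mul _ (hwl 0).coe_nnreal_ennreal
          (hκy y).coe_nnreal_ennreal]
        refine lintegral_congr fun x => ?_
        simp only [Pi.mul_apply]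
        rw [ENNReal.ofReal_mul (NNReal.coe_nonneg _), ENNReal.ofReal_coe_nnreal,
          ENNReal.ofReal_coe_nnreal, mul_comm]
      rw [e]
      exact hq0.ne
    have hyl : ∀ l ∈ Icc (0 : ℝ) 1, Integrable (fun z : ℝ × (Fin n → X) =>
        (κ z.2 y : ℝ) * ((w z.1 z.2 : ℝ) * σ z.1 z.2)) ((volume.restrict (Ioc 0 l)).prod μn) :=
      fun l hl => hy.mono_measure (Measure.prod_mono
        (Measure.restrict_mono (Ioc_subset_Icc_self.trans (Icc_subset_Icc_right hl.2)) le_rfl) le_rfl)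
    have hκw : ∀ l ∈ Icc (0 : ℝ) 1, ∀ x, (κ x y : ℝ) * w l x = (κ x y : ℝ) * w 0 x
        + ∫ t in Ioc 0 l, (κ x y : ℝ) * (w t x * σ t x) := by
      intro l hl x
      have := (prod_density_eq_add_integral hder hcont hcont' x).2 l hl
      rw [integral_const_mul, ← mul_add, ← intervalIntegral.integral_of_le hl.1]
      exact congrArg _ this
    have hintl : ∀ l ∈ Icc (0 : ℝ) 1, Integrable (fun x => (κ x y : ℝ) * w l x) μn := by
      intro l hl
      simp_rw [hκw l hl]
      exact hint0.add (hyl l hl).integral_prod_right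
    refine ofReal_sq_sqrt_sub_sqrt_le (q := fun l => r l y) (h := fun l => h l y) ?_ ?_ ?_ ?_
    · rw [intervalIntegrable_iff_integrableOn_Icc_of_le zero_le_one]
      exact hy.integral_prod_left
    · intro l hl
      simp only [hr, hh]
      rw [intervalIntegral.integral_of_le hl.1, integral_integral_swap (hyl l hl),
        ← integral_add hint0 (hyl l hl).integral_prod_right]
      exact integral_congr_ae (ae_of_all _ fun x => hκw l hl x)
    · intro l _
      exact integral_nonneg fun x => by positivity
    -- If the nonnegative integrand of `r` integrates to zero, it vanishes almost everywhere, and it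
    -- is a factor of the integrand of `h`.
    · intro l hl hz
      have hz' := (integral_eq_zero_iff_of_nonneg (fun x => by positivity) (hintl l hl)).1 hz
      refine integral_eq_zero_of_ae ?_
      filter_upwards [hz'] with x hx
      simp only [Pi.zero_apply] at hx ⊢
      rw [← mul_assoc, hx, zero_mul]
  have htriple : Measurable fun z : (Y × ℝ) × (Fin n → X) => (κ z.2 z.1.1 : ℝ) :=
    (hκ.comp (measurable_snd.prodMk (measurable_fst.comp measurable_fst))).coe_nnreal_real
  have hlx : Measurable fun z : (Y × ℝ) × (Fin n → X) => (z.1.2, z.2) :=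
    (measurable_snd.comp measurable_fst).prodMk measurable_snd
  have hrm : Measurable fun z : Y × ℝ => r z.2 z.1 :=
    ((htriple.mul (hwm.comp hlx).coe_nnreal_real).stronglyMeasurable.integral_prod_right').measurable
  have hhm : Measurable fun z : Y × ℝ => h z.2 z.1 :=
    ((htriple.mul (hgm.comp hlx)).stronglyMeasurable.integral_prod_right').measurable
  have hfin : ∀ l ∈ Icc (0 : ℝ) 1, IsFiniteMeasure (ν.withDensity (q l)) := fun l hl =>
    isFiniteMeasure_withDensity (by simp [hqtot l hl])
  have hfin0 := hfin 0 h0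
  have hfin1 := hfin 1 h1
  calc jsDiv (ν.withDensity (q 0)) (ν.withDensity (q 1))
      ≤ ∫⁻ y, ENNReal.ofReal ((√(q 1 y).toReal - √(q 0 y).toReal) ^ 2) ∂ν :=
        jsDiv_withDensity_le (hqm 0 h0) (hqm 1 h1)
    _ ≤ ∫⁻ y, (∫⁻ l in Icc (0 : ℝ) 1, ENNReal.ofReal (h l y ^ 2 / (4 * r l y))) ∂ν := by
        simp_rw [hqr]
        exact lintegral_mono_ae hcurve
    _ = ∫⁻ l in Icc (0 : ℝ) 1, ∫⁻ y, ENNReal.ofReal (h l y ^ 2 / (4 * r l y)) ∂ν :=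
        lintegral_lintegral_swap
          (((hhm.pow_const 2).div (hrm.const_mul 4)).ennreal_ofReal).aemeasurable
    _ ≤ ∫⁻ l in Icc (0 : ℝ) 1, ENNReal.ofReal (c / 2) *
        klDiv (((P l).prod ν).withDensity fun z => (κ z.1 z.2 : ℝ≥0∞))
          ((P l).prod (ν.withDensity (q l))) := by
        refine setLIntegral_mono' measurableSet_Icc fun l hl => ?_
        have := hprob1 l hl
        have key := lintegral_channel_fisher_le (hsub l hl) hf hf1
        have hPl : (Measure.pi fun _ : Fin n => μ.withDensity fun x => (p l x : ℝ≥0∞)) = P l := by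
          rw [hP]
        rw [hPl] at key
        have e4 : ∀ y, ENNReal.ofReal (h l y ^ 2 / (4 * r l y))
            = ENNReal.ofReal (1 / 4) * ENNReal.ofReal
              ((∫ x, (κ x y : ℝ) * σ l x ∂(P l)) ^ 2 / (q l y).toReal) := by
          intro y
          rw [← ENNReal.ofReal_mul (by norm_num), hhP, hqr]
          congr 1
          rw [div_mul_div_comm, one_mul]
        simp_rw [e4]
        rw [lintegral_const_mul' _ _ ENNReal.ofReal_ne_top]
        -- The factor `1/4` comes from differentiating the square root, `2c` from the transport
        -- inequality.
        have e2 : ENNReal.ofReal (c / 2) = ENNReal.ofReal (1 / 4) * ENNReal.ofReal (2 * c) := by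
          rw [← ENNReal.ofReal_mul (by norm_num)]
          congr 1; ring
        rw [e2, mul_assoc]
        gcongr
    _ = _ := lintegral_const_mul' _ _ ENNReal.ofReal_ne_top

/-! ### The blackboard protocol as a product channel. -/

namespace BlackboardProtocol

variable {d : ℕ} {𝒳 : Type*} [MeasurableSpace 𝒳] {T n : ℕ}
  {𝒴 : Fin T × Fin n → Type*} [∀ a, MeasurableSpace (𝒴 a)] {ν : ∀ a, Measure (𝒴 a)}

/-- The joint transition density of all the messages of node `i`, given its sample. -/
noncomputable def nodeChannel (K : BlackboardProtocol 𝒳 𝒴 ν) (i : Fin n) (x : 𝒳) (π : ∀ a, 𝒴 a) : ℝ≥0 :=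
  ∏ t : Fin T, K.channel (t, i) x (fun b => π b.1) (π (t, i))

/-- For a fixed transcript, grouping the messages by node separates the samples. However interactive
the protocol is, the samples thus remain independent given the transcript. -/
lemma transcriptChannel_eq_prod_nodeChannel (K : BlackboardProtocol 𝒳 𝒴 ν) (x : Fin n → 𝒳)
    (π : ∀ a, 𝒴 a) : K.transcriptChannel x π = ∏ i, K.nodeChannel i (x i) π := by
  rw [transcriptChannel, Fintype.prod_prod_type_right]
  rfl

lemma measurable_nodeChannel (K : BlackboardProtocol 𝒳 𝒴 ν) (i : Fin n) :
    Measurable (Function.uncurry (K.nodeChannel i)) := by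
  change Measurable fun z : 𝒳 × (∀ a, 𝒴 a) => K.nodeChannel i z.1 z.2
  exact Finset.measurable_prod _ fun t _ => K.measurable_channel_message (t, i)

lemma measurable_transcriptChannel (K : BlackboardProtocol 𝒳 𝒴 ν) :
    Measurable fun z : (Fin n → 𝒳) × (∀ a, 𝒴 a) => K.transcriptChannel z.1 z.2 := by
  simp_rw [transcriptChannel_eq_prod_nodeChannel]
  exact measurable_prod_channel K.measurable_nodeChannel

variable [∀ a, SigmaFinite (ν a)]

lemma transcriptLaw_eq_withDensity (K : BlackboardProtocol 𝒳 𝒴 ν) (μ : Measure 𝒳)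
    (p : EuclideanSpace ℝ (Fin d) → 𝒳 → ℝ≥0) (θ : EuclideanSpace ℝ (Fin d))
    [IsProbabilityMeasure (sampleLaw μ p θ)] :
    K.transcriptLaw μ p θ = (Measure.pi ν).withDensity (K.transcriptDensity μ p θ) := by
  have hm : Measurable fun z : (Fin n → 𝒳) × (∀ a, 𝒴 a) =>
    (K.transcriptChannel z.1 z.2 : ℝ≥0∞) := K.measurable_transcriptChannel.coe_nnreal_ennreal
  ext s hs
  rw [transcriptLaw, Measure.snd_apply hs, jointLaw, withDensity_apply _ (measurable_snd hs),
    withDensity_apply _ hs, ← Set.univ_prod, ← Measure.prod_restrict, Measure.restrict_univ,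
    lintegral_prod_symm _ hm.aemeasurable]
  rfl

lemma jointLaw_fst (K : BlackboardProtocol 𝒳 𝒴 ν) (μ : Measure 𝒳)
    (p : EuclideanSpace ℝ (Fin d) → 𝒳 → ℝ≥0) (θ : EuclideanSpace ℝ (Fin d))
    [IsProbabilityMeasure (sampleLaw μ p θ)] :
    (K.jointLaw μ p θ).fst = Measure.pi fun _ : Fin n => sampleLaw μ p θ := by
  have hm : Measurable fun z : (Fin n → 𝒳) × (∀ a, 𝒴 a) =>
    (K.transcriptChannel z.1 z.2 : ℝ≥0∞) := K.measurable_transcriptChannel.coe_nnreal_ennreal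
  ext s hs
  rw [Measure.fst_apply hs, jointLaw, withDensity_apply _ (measurable_fst hs),
    ← Set.prod_univ, ← Measure.prod_restrict, Measure.restrict_univ,
    lintegral_prod _ hm.aemeasurable]
  simp_rw [K.lintegral_transcriptChannel]
  simp

lemma isProbabilityMeasure_transcriptLaw (K : BlackboardProtocol 𝒳 𝒴 ν) (μ : Measure 𝒳)
    (p : EuclideanSpace ℝ (Fin d) → 𝒳 → ℝ≥0) (θ : EuclideanSpace ℝ (Fin d))
    [IsProbabilityMeasure (sampleLaw μ p θ)] :
    IsProbabilityMeasure (K.transcriptLaw μ p θ) := by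
  refine ⟨?_⟩
  rw [transcriptLaw, Measure.snd_univ, ← Measure.fst_univ, jointLaw_fst, measure_univ]

lemma sampleTranscriptInfo_eq (K : BlackboardProtocol 𝒳 𝒴 ν) (μ : Measure 𝒳)
    (p : EuclideanSpace ℝ (Fin d) → 𝒳 → ℝ≥0) (θ : EuclideanSpace ℝ (Fin d))
    [IsProbabilityMeasure (sampleLaw μ p θ)] :
    K.sampleTranscriptInfo μ p θ = klDiv (K.jointLaw μ p θ)
      ((Measure.pi fun _ : Fin n => sampleLaw μ p θ).prod
        ((Measure.pi ν).withDensity (K.transcriptDensity μ p θ))) := by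
  rw [sampleTranscriptInfo, mutualInfo, jointLaw_fst, ← transcriptLaw_eq_withDensity]
  rfl

end BlackboardProtocol

/-! ### Restriction of the model to a segment. -/

lemma isProbabilityMeasure_sampleLaw {d : ℕ} {𝒳 : Type*} [MeasurableSpace 𝒳] {μ : Measure 𝒳} {Θ : Set (EuclideanSpace ℝ (Fin d))}
    {p : EuclideanSpace ℝ (Fin d) → 𝒳 → ℝ≥0} (hp : IsDensityFamily μ Θ p)
    {θ : EuclideanSpace ℝ (Fin d)} (hθ : θ ∈ Θ) : IsProbabilityMeasure (sampleLaw μ p θ) :=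
  ⟨by rw [sampleLaw, withDensity_apply _ MeasurableSet.univ, Measure.restrict_univ, (hp θ hθ).2]⟩

/-- Sub-Gaussianity of the score in an arbitrary direction. -/
lemma SubGaussianScore.hasSubgaussianMGF_inner {d : ℕ} {𝒳 : Type*} [MeasurableSpace 𝒳] {μ : Measure 𝒳}
    {Θ : Set (EuclideanSpace ℝ (Fin d))} {p : EuclideanSpace ℝ (Fin d) → 𝒳 → ℝ≥0} {N : ℝ≥0}
    (hN : SubGaussianScore μ Θ p N) {θ : EuclideanSpace ℝ (Fin d)} (hθ : θ ∈ Θ)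
    [IsProbabilityMeasure (sampleLaw μ p θ)] (v : EuclideanSpace ℝ (Fin d)) :
    HasSubgaussianMGF (fun x => inner ℝ v (score Θ p θ x)) (‖v‖₊ ^ 2 * N ^ 2)
      (sampleLaw μ p θ) := by
  rcases eq_or_ne v 0 with rfl | hv
  · simp only [inner_zero_left, nnnorm_zero, ne_eq, OfNat.ofNat_ne_zero, not_false_eq_true,
      zero_pow, zero_mul]
    exact HasSubgaussianMGF.fun_zero
  have hv' : ‖v‖ ≠ 0 := norm_ne_zero_iff.2 hv
  have h := (hN θ hθ (‖v‖⁻¹ • v) (by rw [norm_smul]; simp [hv'])).const_mul ‖v‖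
  have e : ∀ x, ‖v‖ * inner ℝ (‖v‖⁻¹ • v) (score Θ p θ x) = inner ℝ v (score Θ p θ x) := by
    intro x
    rw [real_inner_smul_left, mul_inv_cancel_left₀ hv']
  simp_rw [e] at h
  exact h

/-- At a point of positive density the score is the logarithmic derivative of the density. -/
lemma inner_score {d : ℕ} {𝒳 : Type*} {Θ : Set (EuclideanSpace ℝ (Fin d))} (hΘ : UniqueDiffOn ℝ Θ)
    {p : EuclideanSpace ℝ (Fin d) → 𝒳 → ℝ≥0} {x : 𝒳}
    (hC : ContDiffOn ℝ 1 (fun θ => √(p θ x : ℝ)) Θ) {θ : EuclideanSpace ℝ (Fin d)} (hθ : θ ∈ Θ)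
    (hpos : p θ x ≠ 0) (v : EuclideanSpace ℝ (Fin d)) :
    inner ℝ v (score Θ p θ x)
      = 2 * √(p θ x : ℝ) * fderivWithin ℝ (fun θ => √(p θ x : ℝ)) Θ θ v / p θ x := by
  have hd := ((hC.differentiableOn one_ne_zero) θ hθ).hasFDerivWithinAt
  have hsq : HasFDerivWithinAt (fun θ => (p θ x : ℝ))
      ((2 * √(p θ x : ℝ)) • fderivWithin ℝ (fun θ => √(p θ x : ℝ)) Θ θ) Θ θ := by
    have := hd.pow 2
    simpa using this
  have hlog := hsq.log (by simpa using hpos)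
  rw [score, gradientWithin, hlog.fderivWithin (hΘ θ hθ), real_inner_comm,
    InnerProductSpace.toDual_symm_apply]
  simp only [FunLike.coe_smul, Pi.smul_apply, smul_eq_mul]
  rw [inv_mul_eq_div]

open Set in
/-- A regular statistical model restricted to a segment: outside a null set the densities and
the directional scores can be chosen jointly measurable, with the densities continuously
differentiable along the segment. -/
lemma exists_regular_path {d : ℕ} {𝒳 : Type*} [MeasurableSpace 𝒳] {μ : Measure 𝒳}
    {Θ : Set (EuclideanSpace ℝ (Fin d))} (hΘ : UniqueDiffOn ℝ Θ)
    {p : EuclideanSpace ℝ (Fin d) → 𝒳 → ℝ≥0} (hp : IsDensityFamily μ Θ p)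
    (h_sqrt : SqrtDensityC1 μ Θ p) {θ₀ θ₁ : EuclideanSpace ℝ (Fin d)}
    (hseg : ∀ l ∈ Icc (0 : ℝ) 1, l • θ₁ + (1 - l) • θ₀ ∈ Θ) :
    ∃ (P : ℝ → 𝒳 → ℝ≥0) (s : ℝ → 𝒳 → ℝ), Measurable (Function.uncurry P) ∧
      Measurable (Function.uncurry s) ∧
      (∀ x, ∀ l ∈ Ioo (0 : ℝ) 1, HasDerivAt (fun l => (P l x : ℝ)) (P l x * s l x) l) ∧
      (∀ x, ContinuousOn (fun l => (P l x : ℝ)) (Icc 0 1)) ∧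
      (∀ x, ContinuousOn (fun l => (P l x : ℝ) * s l x) (Icc 0 1)) ∧
      (∀ l ∈ Icc (0 : ℝ) 1, (μ.withDensity fun x => (P l x : ℝ≥0∞))
        = sampleLaw μ p (l • θ₁ + (1 - l) • θ₀)) ∧
      ∀ l ∈ Icc (0 : ℝ) 1, (fun x => inner ℝ (θ₁ - θ₀) (score Θ p (l • θ₁ + (1 - l) • θ₀) x))
        =ᵐ[sampleLaw μ p (l • θ₁ + (1 - l) • θ₀)] s l := by
  classical
  set v := θ₁ - θ₀ with hv
  -- The parameter is clamped to `[0,1]`, so that the path stays in `Θ` and is continuous on all of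
  -- `ℝ`. Joint measurability then follows from continuity in `l` and measurability in `x`.
  set γ : ℝ → EuclideanSpace ℝ (Fin d) := fun l =>
    (max 0 (min 1 l)) • θ₁ + (1 - max 0 (min 1 l)) • θ₀ with hγ
  have hγΘ : ∀ l, γ l ∈ Θ := fun l => hseg _ ⟨le_max_left _ _, by simp⟩
  have hγc : Continuous γ := by fun_prop
  have hγI : ∀ l ∈ Icc (0 : ℝ) 1, γ l = l • θ₁ + (1 - l) • θ₀ := by
    intro l hl
    simp [hγ, hl.1, hl.2]
  have hγd : ∀ l ∈ Icc (0 : ℝ) 1, HasDerivWithinAt γ v (Icc 0 1) l := by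
    intro l hl
    have h1 : HasDerivAt (fun l : ℝ => l • θ₁ + (1 - l) • θ₀) v l := by
      have := ((hasDerivAt_id l).smul_const θ₁).add
        (((hasDerivAt_id l).const_sub 1).smul_const θ₀)
      refine this.congr_deriv ?_
      simp [hv, sub_eq_add_neg]
    exact h1.hasDerivWithinAt.congr hγI (hγI l hl)
  obtain ⟨X', hX'ae, hX'm, hX'⟩ := h_sqrt.exists_measurable_mem
  set φ : 𝒳 → EuclideanSpace ℝ (Fin d) → ℝ := fun x θ => √(p θ x : ℝ) with hφ
  set P : ℝ → 𝒳 → ℝ≥0 := fun l x => if x ∈ X' then p (γ l) x else 0 with hP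
  set g : ℝ → 𝒳 → ℝ := fun l x =>
    if x ∈ X' then 2 * φ x (γ l) * fderivWithin ℝ (φ x) Θ (γ l) v else 0 with hg
  have hφP : ∀ x ∈ X', ∀ l, (P l x : ℝ) = φ x (γ l) ^ 2 := by
    intro x hx l
    simp [hP, hx, hφ]
  have hφc : ∀ x ∈ X', Continuous fun l => φ x (γ l) := fun x hx =>
    (hX' x hx).continuousOn.comp_continuous hγc hγΘ
  have hPc : ∀ x, Continuous fun l => P l x := by
    intro x
    by_cases hx : x ∈ X'
    · have : Continuous fun l => (P l x : ℝ) := by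
        simp_rw [hφP x hx]
        exact (hφc x hx).pow 2
      exact continuous_induced_rng.2 this
    · simpa [hP, hx] using continuous_const
  have hgc : ∀ x, Continuous fun l => g l x := by
    intro x
    by_cases hx : x ∈ X'
    · simp only [hg, hx, if_true]
      have hD : Continuous fun l => fderivWithin ℝ (φ x) Θ (γ l) :=
        ((hX' x hx).continuousOn_fderivWithin hΘ le_rfl).comp_continuous hγc hγΘ
      exact (continuous_const.mul (hφc x hx)).mul (hD.clm_apply continuous_const)
    · simpa [hg, hx] using continuous_const
  have hPd : ∀ x, ∀ l ∈ Icc (0 : ℝ) 1,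
      HasDerivWithinAt (fun l => (P l x : ℝ)) (g l x) (Icc 0 1) l := by
    intro x l hl
    by_cases hx : x ∈ X'
    · have hd := (((hX' x hx).differentiableOn one_ne_zero) (γ l) (hγΘ l)).hasFDerivWithinAt
      have hcomp : HasDerivWithinAt (fun l => φ x (γ l)) (fderivWithin ℝ (φ x) Θ (γ l) v)
          (Icc 0 1) l := hd.comp_hasDerivWithinAt l (hγd l hl) fun t _ => hγΘ t
      have hsq := hcomp.pow 2
      simp_rw [hφP x hx]
      refine hsq.congr_deriv ?_
      simp [hg, hx]
    · simpa [hP, hg, hx] using hasDerivWithinAt_const l (Icc (0:ℝ) 1) (0 : ℝ)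
  have hPm : ∀ l, Measurable (P l) := fun l =>
    Measurable.ite hX'm (hp _ (hγΘ l)).1 measurable_const
  -- The derivative is measurable in `x` as a limit of difference quotients of `P`, taken inside
  -- `[0,1]` so that the endpoints are covered.
  have hgm : ∀ l, Measurable (g l) := by
    have hgI : ∀ l ∈ Icc (0 : ℝ) 1, Measurable (g l) := by
      intro l hl
      have hne : (nhdsWithin l (Icc (0 : ℝ) 1 \ {l})).NeBot := by
        have := uniqueDiffWithinAt_iff_accPt.1 (uniqueDiffOn_Icc_zero_one l hl)
        rwa [accPt_principal_iff_nhdsWithin] at this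
      refine measurable_of_tendsto_metrizable' (nhdsWithin l (Icc (0 : ℝ) 1 \ {l}))
        (f := fun t x => slope (fun l => (P l x : ℝ)) l t) (fun t => ?_) ?_
      · simp only [slope_def_field]
        exact ((hPm t).coe_nnreal_real.sub (hPm l).coe_nnreal_real).div_const _
      · rw [tendsto_pi_nhds]
        exact fun x => hasDerivWithinAt_iff_tendsto_slope.1 (hPd x l hl)
    intro l
    have hcl : max 0 (min 1 l) ∈ Icc (0 : ℝ) 1 := ⟨le_max_left _ _, by simp⟩
    have e : g l = g (max 0 (min 1 l)) := by
      have : γ (max 0 (min 1 l)) = γ l := by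
        rw [hγI _ hcl]
      funext x
      simp only [hg, this]
    rw [e]
    exact hgI _ hcl
  have hPu : Measurable (Function.uncurry P) :=
    measurable_uncurry_of_continuous_of_measurable hPc hPm
  have hgu : Measurable (Function.uncurry g) :=
    measurable_uncurry_of_continuous_of_measurable hgc hgm
  -- At a zero of `P` the square root `φ` vanishes, hence so does `g = 2 φ φ'`; division by zero
  -- does no harm.
  have hPs : ∀ l x, (P l x : ℝ) * (g l x / P l x) = g l x := by
    intro l x
    by_cases h0 : (P l x : ℝ) = 0
    · rw [h0, zero_mul]
      by_cases hx : x ∈ X'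
      · have := hφP x hx l
        rw [h0, eq_comm, sq_eq_zero_iff] at this
        simp [hg, hx, this]
      · simp [hg, hx]
    · field_simp
  refine ⟨P, fun l x => g l x / P l x, hPu, hgu.div hPu.coe_nnreal_real, ?_, ?_, ?_, ?_, ?_⟩
  · intro x l hl
    rw [hPs]
    exact (hPd x l (Ioo_subset_Icc_self hl)).hasDerivAt (Icc_mem_nhds hl.1 hl.2)
  · exact fun x => (NNReal.continuous_coe.comp (hPc x)).continuousOn
  · intro x
    simp_rw [hPs]
    exact (hgc x).continuousOn
  · intro l hl
    rw [sampleLaw, ← hγI l hl]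
    refine withDensity_congr_ae ?_
    filter_upwards [hX'ae] with x hx
    simp [hP, hx]
  · intro l hl
    -- The scores need to agree only where the density is positive, and there the logarithm is
    -- differentiable.
    rw [sampleLaw, ← hγI l hl, Filter.EventuallyEq,
      ae_withDensity_iff (hp _ (hγΘ l)).1.coe_nnreal_ennreal]
    filter_upwards [hX'ae] with x hx hpx
    rw [inner_score hΘ (hX' x hx) (hγΘ l) (by simpa using hpx)]
    simp [hg, hP, hx, hφ]

/-! ### Assembly of the bound and its fair-bit form. -/

theorem theorem2
    {d T n : ℕ} {𝒳 : Type*} [MeasurableSpace 𝒳] (μ : Measure 𝒳) [SigmaFinite μ]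
    (𝒴 : Fin T × Fin n → Type*) [∀ a, MeasurableSpace (𝒴 a)]
    (ν : ∀ a, Measure (𝒴 a)) [∀ a, SigmaFinite (ν a)]
    -- the parameter set: gradients within `Θ` are well defined at every point
    (Θ : Set (EuclideanSpace ℝ (Fin d))) (hΘ : UniqueDiffOn ℝ Θ)
    (p : EuclideanSpace ℝ (Fin d) → 𝒳 → ℝ≥0) (hp : IsDensityFamily μ Θ p)
    (K : BlackboardProtocol 𝒳 𝒴 ν)
    -- regularity conditions
    (h_sqrt : SqrtDensityC1 μ Θ p)
    (h_fisher : FisherContinuous μ Θ p)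
    (h_channel : K.SquareIntegrableChannel μ Θ p)
    (h_taylor : K.UniformJSTaylor μ Θ p)
    -- sub-Gaussian score
    (N : ℝ≥0) (hN : SubGaussianScore μ Θ p N)
    -- the segment from `θ₀` to `θ₁` lies in `Θ`
    (θ₀ θ₁ : EuclideanSpace ℝ (Fin d))
    (hseg : ∀ l ∈ Set.Icc (0 : ℝ) 1, l • θ₁ + (1 - l) • θ₀ ∈ Θ) :
    jsDiv (K.transcriptLaw μ p θ₀) (K.transcriptLaw μ p θ₁)
        ≤ ENNReal.ofReal (‖θ₁ - θ₀‖ ^ 2 * (N : ℝ) ^ 2 / 2) *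
          ∫⁻ l in Set.Icc (0 : ℝ) 1, K.sampleTranscriptInfo μ p (l • θ₁ + (1 - l) • θ₀) ∧
    mutualInfo (fairMixture (K.transcriptLaw μ p θ₀) (K.transcriptLaw μ p θ₁))
        = (2 : ℝ≥0∞)⁻¹ * jsDiv (K.transcriptLaw μ p θ₀) (K.transcriptLaw μ p θ₁) ∧
    mutualInfo (fairMixture (K.transcriptLaw μ p θ₀) (K.transcriptLaw μ p θ₁))
        ≤ ENNReal.ofReal (‖θ₁ - θ₀‖ ^ 2 * (N : ℝ) ^ 2 / 4) *
          ∫⁻ l in Set.Icc (0 : ℝ) 1, K.sampleTranscriptInfo μ p (l • θ₁ + (1 - l) • θ₀) := by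
  have hprob : ∀ l ∈ Set.Icc (0 : ℝ) 1,
      IsProbabilityMeasure (sampleLaw μ p (l • θ₁ + (1 - l) • θ₀)) := fun l hl =>
    isProbabilityMeasure_sampleLaw hp (hseg l hl)
  have h0 : (0 : ℝ) ∈ Set.Icc (0 : ℝ) 1 := by simp
  have h1 : (1 : ℝ) ∈ Set.Icc (0 : ℝ) 1 := by simp
  have e0 : (0 : ℝ) • θ₁ + (1 - (0 : ℝ)) • θ₀ = θ₀ := by simp
  have e1 : (1 : ℝ) • θ₁ + (1 - (1 : ℝ)) • θ₀ = θ₁ := by simp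
  have hp0 : IsProbabilityMeasure (sampleLaw μ p θ₀) := e0 ▸ hprob 0 h0
  have hp1 : IsProbabilityMeasure (sampleLaw μ p θ₁) := e1 ▸ hprob 1 h1
  have hmain : jsDiv (K.transcriptLaw μ p θ₀) (K.transcriptLaw μ p θ₁)
      ≤ ENNReal.ofReal (‖θ₁ - θ₀‖ ^ 2 * (N : ℝ) ^ 2 / 2) *
        ∫⁻ l in Set.Icc (0 : ℝ) 1, K.sampleTranscriptInfo μ p (l • θ₁ + (1 - l) • θ₀) := by
    obtain ⟨P, s, hPm, hsm, hder, hcont, hcont', hlaw, hscore⟩ :=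
      exists_regular_path hΘ hp h_sqrt hseg
    have hsub : ∀ l ∈ Set.Icc (0 : ℝ) 1, HasSubgaussianMGF (s l) (‖θ₁ - θ₀‖₊ ^ 2 * N ^ 2)
        (μ.withDensity fun x => (P l x : ℝ≥0∞)) := by
      intro l hl
      have := hprob l hl
      rw [hlaw l hl]
      exact (hN.hasSubgaussianMGF_inner (hseg l hl) (θ₁ - θ₀)).congr (hscore l hl)
    have hP1 : ∀ l ∈ Set.Icc (0 : ℝ) 1, ∫⁻ x, (P l x : ℝ≥0∞) ∂μ = 1 := by
      intro l hl
      have := hprob l hl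
      have h := measure_univ (μ := sampleLaw μ p (l • θ₁ + (1 - l) • θ₀))
      rwa [← hlaw l hl, withDensity_apply _ MeasurableSet.univ, Measure.restrict_univ] at h
    have key := jsDiv_channel_le hPm hsm hP1 hder hcont hcont' hsub
      (ν := Measure.pi ν) (f := K.nodeChannel) K.measurable_nodeChannel
      (fun x => by
        simp_rw [← K.transcriptChannel_eq_prod_nodeChannel]
        exact K.lintegral_transcriptChannel x) rfl
    simp_rw [← K.transcriptChannel_eq_prod_nodeChannel] at key
    rw [hlaw 0 h0, hlaw 1 h1, e0, e1] at key
    rw [K.transcriptLaw_eq_withDensity, K.transcriptLaw_eq_withDensity]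
    refine key.trans (le_of_eq ?_)
    congr 1
    refine setLIntegral_congr_fun measurableSet_Icc fun l hl => ?_
    have := hprob l hl
    rw [hlaw l hl, K.sampleTranscriptInfo_eq]
    rfl
  have hQ0 := K.isProbabilityMeasure_transcriptLaw μ p θ₀
  have hQ1 := K.isProbabilityMeasure_transcriptLaw μ p θ₁
  have hmi := mutualInfo_fairMixture (K.transcriptLaw μ p θ₀) (K.transcriptLaw μ p θ₁)
  refine ⟨hmain, hmi, ?_⟩
  rw [hmi]
  have e4 : ENNReal.ofReal (‖θ₁ - θ₀‖ ^ 2 * (N : ℝ) ^ 2 / 4)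
      = (2 : ℝ≥0∞)⁻¹ * ENNReal.ofReal (‖θ₁ - θ₀‖ ^ 2 * (N : ℝ) ^ 2 / 2) := by
    have e2 : (2 : ℝ≥0∞)⁻¹ = ENNReal.ofReal 2⁻¹ := by
      rw [ENNReal.ofReal_inv_of_pos two_pos, ENNReal.ofReal_ofNat]
    rw [e2, ← ENNReal.ofReal_mul (by norm_num)]
    congr 1; ring
  rw [e4, mul_assoc]
  gcongr
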